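/- Let $\Omega\subset\mathbb{R}^2$ be a compact domain given by a planar straight line graph (PSLG): a proper planar drawing with finitely many vertices and straight segments, all contained in $\Omega$, whose segments contain the boundary $\partial\Omega$. Assume that any two segments with a common endpoint enclose an angle of at least $\pi/2$. Let $L$ be the diameter of $\Omega$ and $s=\min_{x\in\Omega}\mathrm{lfs}(x)$, where $\mathrm{lfs}(x)$ is the radius of the smallest disk centered at $x$ that touches two non-incident input features (vertices or segments; features are non-incident if they have no common endpoint). Let $\beta\ge\sqrt2$. The diametral circle of a segment is the circle having it as a diameter; a point encroaches the segment if it is strictly inside that circle. The parallel implementation of Chew's refinement works as follows. *Preprocessing.* While some segments have a diametral circle whose interior meets a feature not incident to the segment, split all these segments in parallel at their midpoints. *Refinement.* In each iteration consider the current Delaunay mesh, i.e. the Delaunay simplices of the current vertices that lie in $\Omega$. A triangle is poorly shaped if its circumradius exceeds $\beta$ times the length of the shortest edge of the current mesh. Let $\mathcal B$ (respectively $\mathcal C$) be the set of circumcircles of poorly shaped triangles whose centers encroach (respectively do not encroach) some current segment. Two circumcircles conflict if each has the other's center strictly inside. Choose any maximal independent (i.e. pairwise non-conflicting) subset $\mathcal{BC}$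 of $\mathcal B\cup\mathcal C$, and let $\mathcal D$ be the set of diametral circles encroached by centers of $\mathcal{BC}$. A circumcircle $c$ and a diametral circle $d$ conflict if the center of $d$ is strictly inside $c$ and the radius of $c$ is smaller than $\sqrt2$ times the radius of $d$; two diametral circles never conflict. Stop if $(\mathcal{BC}\cap\mathcal C)\cup\mathcal D$ is empty; otherwise choose a maximal independent subset $\mathcal I$ of it with $\mathcal D\subseteq\mathcal I$, insert the centers of all circles in $\mathcal I$ as vertices, and replace each segment whose midpoint is inserted by its two halves. Then there is an absolute constant $C>0$ such that, for all such $\Omega$ and $\beta$ and all choices of independent sets, the algorithm terminates, and the total number of its iterations (preprocessing and refinement) is at most $C\log(L/s)$. Moreover, as long as a poorly shaped triangle is present, a further refinement iteration is possible, so the algorithm stops only when there is none. -/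

import Mathlib

namespace ChewRefinement

/-- The Euclidean plane. -/
abbrev Plane : Type := EuclideanSpace ℝ (Fin 2)

/-- A line segment, given by its two endpoints (each segment of a drawing is stored once, with an
arbitrary orientation). -/
abbrev Seg : Type := Plane × Plane

/-- The points of a segment.  The carrier of the degenerate pair `(v, v)` is `{v}`. -/
def Seg.carrier (e : Seg) : Set Plane := segment ℝ e.1 e.2

/-- The midpoint of a segment, i.e. the centre of its diametral circle. -/
noncomputable def Seg.mid (e : Seg) : Plane := midpoint ℝ e.1 e.2

/-- The radius of the diametral circle of a segment. -/
noncomputable def Seg.radius (e : Seg) : ℝ := dist e.1 e.2 / 2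

/-- The (open) disc bounded by the diametral circle of a segment. -/
def Seg.disc (e : Seg) : Set Plane := Metric.ball e.mid e.radius

/-- The raw data of a straight line drawing: its vertices and its segments. -/
structure Drawing where
  verts : Set Plane
  segs : Set Seg

/-- A planar straight line graph: a proper planar drawing with finitely many vertices and
segments.  A vertex lies on a segment only as one of its endpoints, and two different segments
meet only in vertices. -/
structure Drawing.IsPSLG (D : Drawing) : Prop where
  finite_verts : D.verts.Finite
  finite_segs : D.segs.Finite
  fst_mem : ∀ e ∈ D.segs, e.1 ∈ D.verts
  snd_mem : ∀ e ∈ D.segs, e.2 ∈ D.verts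
  fst_ne_snd : ∀ e ∈ D.segs, e.1 ≠ e.2
  vert_on_seg : ∀ e ∈ D.segs, ∀ v ∈ D.verts, v ∈ e.carrier → v = e.1 ∨ v = e.2
  seg_inter_seg : ∀ e ∈ D.segs, ∀ f ∈ D.segs, e ≠ f → e.carrier ∩ f.carrier ⊆ D.verts

/-- Any two different segments with a common vertex `p` enclose an angle of at least `π / 2`. -/
def Drawing.AnglesAtLeastRight (D : Drawing) : Prop :=
  ∀ e ∈ D.segs, ∀ f ∈ D.segs, e ≠ f → ∀ p q r : Plane,
    (e = (p, q) ∨ e = (q, p)) → (f = (p, r) ∨ f = (r, p)) →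
      Real.pi / 2 ≤ EuclideanGeometry.angle q p r

/-- `Ω` is a bounded closed region described by the drawing: its boundary consists of segments of
the drawing, and all vertices and segments lie in it (segments and vertices in the interior of `Ω`,
holes, and non-convex regions are allowed). -/
structure Drawing.Describes (D : Drawing) (Ω : Set Plane) : Prop where
  isCompact : IsCompact Ω
  frontier_subset : frontier Ω ⊆ ⋃ e ∈ D.segs, e.carrier
  verts_subset : D.verts ⊆ Ω
  segs_subset : ∀ e ∈ D.segs, e.carrier ⊆ Ω

/-- The input features: the segments, and the vertices `v`, the latter written `(v, v)`. -/
def Drawing.features (D : Drawing) : Set Seg := D.segs ∪ (fun v => (v, v)) '' D.verts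

/-- Two features are non-incident: they are two different vertices, or a vertex and a segment of
which it is not an endpoint, or two segments without a common endpoint. -/
def NonIncident (e f : Seg) : Prop := e.1 ≠ f.1 ∧ e.1 ≠ f.2 ∧ e.2 ≠ f.1 ∧ e.2 ≠ f.2

/-- Local feature size: the radius of the smallest disc centred at `x` that touches two
non-incident features. -/
noncomputable def Drawing.lfs (D : Drawing) (x : Plane) : ℝ :=
  sInf {r : ℝ | 0 ≤ r ∧ ∃ e ∈ D.features, ∃ f ∈ D.features, NonIncident e f ∧
    (Metric.closedBall x r ∩ e.carrier).Nonempty ∧ (Metric.closedBall x r ∩ f.carrier).Nonempty}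

/-- The smallest local feature size of the points of `Ω`. -/
noncomputable def Drawing.minLfs (D : Drawing) (Ω : Set Plane) : ℝ := sInf (D.lfs '' Ω)

/-! ### The Delaunay mesh of the region -/

/-- `p q` is a Delaunay edge of the point set `P` that lies in `Ω`: some circle through `p` and `q`
has no point of `P` in its interior. -/
def IsDelaunayEdge (Ω P : Set Plane) (p q : Plane) : Prop :=
  p ∈ P ∧ q ∈ P ∧ p ≠ q ∧ segment ℝ p q ⊆ Ω ∧
    ∃ c : Plane, dist p c = dist q c ∧ ∀ v ∈ P, dist p c ≤ dist v c

/-- `p q t` is a (nondegenerate) Delaunay triangle of the point set `P` that lies in `Ω`, and its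
circumcircle has centre `c` and radius `r`. -/
def IsDelaunayTriangle (Ω P : Set Plane) (p q t c : Plane) (r : ℝ) : Prop :=
  p ∈ P ∧ q ∈ P ∧ t ∈ P ∧ AffineIndependent ℝ ![p, q, t] ∧ convexHull ℝ {p, q, t} ⊆ Ω ∧
    dist p c = r ∧ dist q c = r ∧ dist t c = r ∧ ∀ v ∈ P, r ≤ dist v c

/-- The length of the shortest edge in the current Delaunay mesh. -/
noncomputable def shortestEdge (Ω P : Set Plane) : ℝ :=
  sInf {l : ℝ | ∃ p q, IsDelaunayEdge Ω P p q ∧ l = dist p q}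

/-- The circumcircles (centre, radius) of the triangles that are poorly shaped in the sense of
Chew's refinement: the ratio of the circumradius to the length of the shortest edge in the current
mesh is more than `β`. -/
def poorCircles (β : ℝ) (Ω P : Set Plane) : Set (Plane × ℝ) :=
  {c | (∃ p q t, IsDelaunayTriangle Ω P p q t c.1 c.2) ∧ β * shortestEdge Ω P < c.2}

/-! ### Candidates and independence -/

/-- A candidate for insertion: the centre of a circumcircle `(centre, radius)`, or the centre of
the diametral circle of a segment. -/
abbrev Candidate : Type := (Plane × ℝ) ⊕ Seg

/-- The point that a candidate inserts. -/
noncomputable def Candidate.center : Candidate → Plane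
  | Sum.inl c => c.1
  | Sum.inr d => d.mid

/-- A circumcircle `c` and a diametral circle `d` conflict if the centre of `d` is inside `c` and
the radius of `c` is smaller than `√2` times the radius of `d`. -/
def ConflictDiametral (c : Plane × ℝ) (d : Seg) : Prop :=
  dist d.mid c.1 < c.2 ∧ c.2 < √2 * d.radius

/-- Two circumcircles conflict if both contain each other's centre; two diametral circles never
conflict. -/
def Conflict : Candidate → Candidate → Prop
  | Sum.inl a, Sum.inl b => dist a.1 b.1 < a.2 ∧ dist a.1 b.1 < b.2
  | Sum.inl c, Sum.inr d => ConflictDiametral c d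
  | Sum.inr d, Sum.inl c => ConflictDiametral c d
  | Sum.inr _, Sum.inr _ => False

/-- `I` is a maximal independent subset of `K`. -/
def IsMaximalIndependent (K I : Set Candidate) : Prop :=
  Maximal (fun J : Set Candidate => J ⊆ K ∧ J.Pairwise fun a b => ¬ Conflict a b) I

/-- A point encroaches some segment of the drawing if it is inside its diametral circle. -/
def Drawing.Encroaches (D : Drawing) (x : Plane) : Prop := ∃ e ∈ D.segs, x ∈ e.disc

/-- Circumcircles of poorly shaped triangles whose centres encroach some segment. -/
def Drawing.setB (β : ℝ) (Ω : Set Plane) (D : Drawing) : Set Candidate :=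
  Sum.inl '' {c ∈ poorCircles β Ω D.verts | D.Encroaches c.1}

/-- Circumcircles of poorly shaped triangles whose centres do not encroach any segment. -/
def Drawing.setC (β : ℝ) (Ω : Set Plane) (D : Drawing) : Set Candidate :=
  Sum.inl '' {c ∈ poorCircles β Ω D.verts | ¬ D.Encroaches c.1}

/-- The diametral circles of segments encroached by centres in `BC`. -/
def Drawing.setD (D : Drawing) (BC : Set Candidate) : Set Candidate :=
  Sum.inr '' {e ∈ D.segs | ∃ c ∈ BC, c.center ∈ e.disc}

/-- Insertion of a set of candidates: their centres become vertices, and every segment whose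
midpoint is inserted is replaced by its two halves. -/
def Drawing.insertAll (D : Drawing) (I : Set Candidate) : Drawing where
  verts := D.verts ∪ Candidate.center '' I
  segs := {e ∈ D.segs | Sum.inr e ∉ I} ∪
    {h : Seg | ∃ e ∈ D.segs, Sum.inr e ∈ I ∧ (h = (e.1, e.mid) ∨ h = (e.mid, e.2))}

/-! ### The algorithm -/

/-- The segments that the preprocessing still has to split: those whose diametral disc meets a
non-incident feature. -/
def Drawing.bad (D : Drawing) : Set Seg :=
  {e ∈ D.segs | ∃ f ∈ D.features, NonIncident e f ∧ (e.disc ∩ f.carrier).Nonempty}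

/-- One iteration of the boundary preprocessing: all bad segments are split at their midpoints. -/
def Drawing.preStep (D : Drawing) : Drawing := D.insertAll (Sum.inr '' D.bad)

/-- The preprocessing loop, started on `D`, stops after exactly `m` iterations with `D'`. -/
def Preprocess (D : Drawing) (m : ℕ) (D' : Drawing) : Prop :=
  D' = Drawing.preStep^[m] D ∧ D'.bad = ∅ ∧ ∀ j < m, (Drawing.preStep^[j] D).bad.Nonempty

/-- One iteration of the refinement loop, from `D` to `D'`.  A maximal independent set `BC` of the
poor circumcircles is selected; the candidates are the non-encroaching members of `BC` and the
diametral circles encroached by `BC`; if there are candidates, then a maximal independent set `I`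
of them that includes all diametral ones is inserted. -/
def RefineStep (β : ℝ) (Ω : Set Plane) (D D' : Drawing) : Prop :=
  ∃ BC I : Set Candidate,
    IsMaximalIndependent (D.setB β Ω ∪ D.setC β Ω) BC ∧
    ((BC ∩ D.setC β Ω) ∪ D.setD BC).Nonempty ∧
    IsMaximalIndependent ((BC ∩ D.setC β Ω) ∪ D.setD BC) I ∧
    D.setD BC ⊆ I ∧
    D' = D.insertAll I

/-- `M 0, …, M n` are the first `n` iterations of some run of the refinement loop from `D`. -/
def IsRefinementRun (β : ℝ) (Ω : Set Plane) (D : Drawing) (n : ℕ) (M : ℕ → Drawing) : Prop :=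
  M 0 = D ∧ ∀ i < n, RefineStep β Ω (M i) (M (i + 1))

end ChewRefinement

namespace ChewRefinement

/-! ### Coordinates in the plane -/

/-! Both phases are logarithmic because a length scale halves after boundedly many iterations while
staying between about `s` and `L`.

Preprocessing: a split never makes another segment bad, so a segment that is bad after `j`
iterations has been halved `j` times and has radius at most `L / 2 ^ j`. A bad segment lies in an
input feature and its diametral disc meets a non-incident one, so its radius is at least `s`.
`Drawing.SplitsFrom` carries this link to the input; the angle condition enters only at its start.
The outcome is `Drawing.Conforming`: a diametral disc contains no vertex and no point of another
segment. Refinement preserves this (`Drawing.Conforming.insertAll`).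

Geometry of conforming drawings: no segment separates a Delaunay triangle from its circumcentre, so
circumcentres stay in the closure of the interior of `Ω`. Conversely, every point of that closure
whose distance to all vertices exceeds a `ρ` that is at least `β` times the shortest edge has a poor
circumcircle of radius above `ρ` nearby (`Drawing.Conforming.exists_poorCircle`).

Refinement: independence, non-encroachment and `√2 ≤ β` keep every new vertex farther from all
others than the current shortest edge. Hence vertices stay `s`-separated and poor radii exceed `s`.
A poor circle of a late mesh is also empty of the fewer earlier vertices, so it has a poor circle of
comparable size nearby in every earlier mesh (`IsRefinementRun.exists_earlier`), and there each
iteration inserts a point at distance at least `ρ / 8` from all vertices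
(`StepData.exists_new_vertex`). If a radius above `ρ / 2` survived too many iterations, these points
would violate a packing bound. So a constant number of iterations halves the largest poor radius
(`IsRefinementRun.radius_le_half`).

Progress (`exists_refineStep`) is combinatorial: a selected circle is itself a candidate or makes a
diametral circle one. -/

/-- Twice the signed area of the triangle `a b x`. -/
def cross (a b x : Plane) : ℝ := (b 0 - a 0) * (x 1 - a 1) - (b 1 - a 1) * (x 0 - a 0)

/-- The power of a point with respect to the diametral circle of a segment. -/
def thales (e : Seg) (x : Plane) : ℝ :=
  (x 0 - e.1 0) * (x 0 - e.2 0) + (x 1 - e.1 1) * (x 1 - e.2 1)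

/-- The triangle `p q t` without its boundary. -/
def openTriangle (p q t : Plane) : Set Plane :=
  {x | ∃ a b c : ℝ, 0 < a ∧ 0 < b ∧ 0 < c ∧ a + b + c = 1 ∧ x = a • p + b • q + c • t}

theorem plane_ext {x y : Plane} (h0 : x 0 = y 0) (h1 : x 1 = y 1) : x = y := by
  ext i
  fin_cases i
  · exact h0
  · exact h1

theorem dist_sq (x y : Plane) : dist x y ^ 2 = (x 0 - y 0) ^ 2 + (x 1 - y 1) ^ 2 := by
  rw [EuclideanSpace.dist_eq, Real.sq_sqrt (by positivity)]
  simp [Fin.sum_univ_two, Real.dist_eq, sq_abs]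

theorem lt_dist_iff {x y : Plane} {r : ℝ} (hr : 0 ≤ r) :
    r < dist x y ↔ r ^ 2 < (x 0 - y 0) ^ 2 + (x 1 - y 1) ^ 2 := by
  rw [← dist_sq, sq_lt_sq₀ hr dist_nonneg]

theorem le_dist_iff {x y : Plane} {r : ℝ} (hr : 0 ≤ r) :
    r ≤ dist x y ↔ r ^ 2 ≤ (x 0 - y 0) ^ 2 + (x 1 - y 1) ^ 2 := by
  rw [← dist_sq, sq_le_sq₀ hr dist_nonneg]

theorem dist_lt_iff {x y : Plane} {r : ℝ} (hr : 0 ≤ r) :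
    dist x y < r ↔ (x 0 - y 0) ^ 2 + (x 1 - y 1) ^ 2 < r ^ 2 := by
  rw [← dist_sq, sq_lt_sq₀ dist_nonneg hr]

theorem Seg.radius_nonneg (e : Seg) : 0 ≤ e.radius := by
  unfold Seg.radius
  positivity

theorem Seg.radius_pos {e : Seg} (h : e.1 ≠ e.2) : 0 < e.radius := by
  have := dist_pos.2 h
  unfold Seg.radius
  positivity

theorem Seg.mid_apply (e : Seg) (i : Fin 2) : e.mid i = (e.1 i + e.2 i) / 2 := by
  simp [Seg.mid, midpoint_eq_smul_add]
  ring

theorem Seg.radius_sq (e : Seg) :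
    e.radius ^ 2 = ((e.1 0 - e.2 0) ^ 2 + (e.1 1 - e.2 1) ^ 2) / 4 := by
  unfold Seg.radius
  rw [div_pow, dist_sq]
  norm_num

theorem thales_eq (e : Seg) (x : Plane) : thales e x = dist x e.mid ^ 2 - e.radius ^ 2 := by
  rw [dist_sq, e.radius_sq, e.mid_apply, e.mid_apply, thales]
  ring

theorem mem_disc_iff {e : Seg} {x : Plane} : x ∈ e.disc ↔ thales e x < 0 := by
  rw [thales_eq, Seg.disc, Metric.mem_ball, sub_neg, sq_lt_sq₀ dist_nonneg e.radius_nonneg]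

theorem notMem_disc_iff {e : Seg} {x : Plane} : x ∉ e.disc ↔ 0 ≤ thales e x := by
  rw [mem_disc_iff, not_lt]

theorem radius_le_dist {e : Seg} {x : Plane} (h : x ∉ e.disc) : e.radius ≤ dist x e.mid := by
  simpa [Seg.disc] using h

theorem fst_notMem_disc (e : Seg) : e.1 ∉ e.disc := by
  rw [notMem_disc_iff, thales]
  simp

theorem snd_notMem_disc (e : Seg) : e.2 ∉ e.disc := by
  rw [notMem_disc_iff, thales]
  simp

theorem mid_mem_disc {e : Seg} (h : e.1 ≠ e.2) : e.mid ∈ e.disc := by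
  simpa [Seg.disc] using Seg.radius_pos h

theorem mem_carrier_iff {e : Seg} {x : Plane} : x ∈ e.carrier ↔ ∃ a b : ℝ, 0 ≤ a ∧ 0 ≤ b ∧
    a + b = 1 ∧ x 0 = a * e.1 0 + b * e.2 0 ∧ x 1 = a * e.1 1 + b * e.2 1 := by
  constructor
  · rintro ⟨a, b, ha, hb, hab, rfl⟩
    exact ⟨a, b, ha, hb, hab, by simp, by simp⟩
  · rintro ⟨a, b, ha, hb, hab, h0, h1⟩
    exact ⟨a, b, ha, hb, hab, plane_ext (by simp [h0]) (by simp [h1])⟩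

theorem fst_mem_carrier (e : Seg) : e.1 ∈ e.carrier := left_mem_segment ℝ _ _

theorem snd_mem_carrier (e : Seg) : e.2 ∈ e.carrier := right_mem_segment ℝ _ _

theorem mid_mem_carrier (e : Seg) : e.mid ∈ e.carrier := midpoint_mem_segment _ _

theorem carrier_vertex (v : Plane) : Seg.carrier (v, v) = {v} := segment_same ℝ v

theorem cross_carrier {e : Seg} {x : Plane} (h : x ∈ e.carrier) : cross e.1 e.2 x = 0 := by
  obtain ⟨a, b, -, -, hab, h0, h1⟩ := mem_carrier_iff.1 h
  obtain rfl : b = 1 - a := by linarith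
  rw [cross, h0, h1]
  ring

theorem mem_openTriangle_iff {p q t x : Plane} : x ∈ openTriangle p q t ↔
    ∃ a b c : ℝ, 0 < a ∧ 0 < b ∧ 0 < c ∧ a + b + c = 1 ∧
      x 0 = a * p 0 + b * q 0 + c * t 0 ∧ x 1 = a * p 1 + b * q 1 + c * t 1 := by
  constructor
  · rintro ⟨a, b, c, ha, hb, hc, h, rfl⟩
    exact ⟨a, b, c, ha, hb, hc, h, by simp, by simp⟩
  · rintro ⟨a, b, c, ha, hb, hc, h, h0, h1⟩
    exact ⟨a, b, c, ha, hb, hc, h, plane_ext (by simp [h0]) (by simp [h1])⟩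

theorem cross_eq_zero_iff {p q t : Plane} (hpq : p ≠ q) :
    cross p q t = 0 ↔ ∃ s : ℝ, t = AffineMap.lineMap p q s := by
  constructor
  · intro h
    rw [cross] at h
    have hN : 0 < (q 0 - p 0) ^ 2 + (q 1 - p 1) ^ 2 := by
      rw [← dist_sq]
      exact pow_pos (dist_pos.2 hpq.symm) 2
    refine ⟨((q 0 - p 0) * (t 0 - p 0) + (q 1 - p 1) * (t 1 - p 1)) /
      ((q 0 - p 0) ^ 2 + (q 1 - p 1) ^ 2), plane_ext ?_ ?_⟩
    · simp only [AffineMap.lineMap_apply, vsub_eq_sub, vadd_eq_add, PiLp.add_apply,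
        PiLp.smul_apply, PiLp.sub_apply, smul_eq_mul]
      field_simp
      linear_combination -(q 1 - p 1) * h
    · simp only [AffineMap.lineMap_apply, vsub_eq_sub, vadd_eq_add, PiLp.add_apply,
        PiLp.smul_apply, PiLp.sub_apply, smul_eq_mul]
      field_simp
      linear_combination (q 0 - p 0) * h
  · rintro ⟨s, rfl⟩
    simp only [cross, AffineMap.lineMap_apply, vsub_eq_sub, vadd_eq_add, PiLp.add_apply,
        PiLp.smul_apply, PiLp.sub_apply, smul_eq_mul]
    ring

theorem affineIndependent_iff_cross_ne_zero {p q t : Plane} :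
    AffineIndependent ℝ ![p, q, t] ↔ cross p q t ≠ 0 := by
  rw [affineIndependent_iff_not_collinear_set, Ne, not_iff_not]
  rcases eq_or_ne p q with rfl | hpq
  · simp [collinear_pair, cross]
  · constructor
    · intro h
      obtain ⟨v, hv⟩ := (collinear_iff_of_mem (p₀ := p) (by simp)).1 h
      obtain ⟨r, rfl⟩ := hv q (by simp)
      obtain ⟨s, rfl⟩ := hv t (by simp)
      simp [cross]
      ring
    · rw [cross_eq_zero_iff hpq]
      rintro ⟨s, rfl⟩
      have := collinear_insert_of_mem_affineSpan_pair
        (AffineMap.lineMap_mem_affineSpan_pair s p q)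
      exact this.subset (by intro x; simp only [Set.mem_insert_iff, Set.mem_singleton_iff]; tauto)

/-! ### Circumcentres and open triangles -/

theorem exists_circumcenter {p q t : Plane} (h : cross p q t ≠ 0) :
    ∃ c : Plane, dist q c = dist p c ∧ dist t c = dist p c := by
  set A := ((q 0 - p 0) ^ 2 + (q 1 - p 1) ^ 2) / 2 with hA
  set B := ((t 0 - p 0) ^ 2 + (t 1 - p 1) ^ 2) / 2 with hB
  have hc := h
  rw [cross] at h
  -- Cramer's rule for the two perpendicular bisector equations, with `p` as origin.
  refine ⟨!₂[p 0 + (A * (t 1 - p 1) - B * (q 1 - p 1)) / cross p q t,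
    p 1 + (B * (q 0 - p 0) - A * (t 0 - p 0)) / cross p q t], ?_, ?_⟩
  all_goals
    rw [← sq_eq_sq₀ dist_nonneg dist_nonneg, dist_sq, dist_sq]
    simp only [Matrix.cons_val_zero, Matrix.cons_val_one]
    set X := (A * (t 1 - p 1) - B * (q 1 - p 1)) / cross p q t with hX
    set Y := (B * (q 0 - p 0) - A * (t 0 - p 0)) / cross p q t with hY
    rw [eq_div_iff hc, cross] at hX hY
  · have : (q 0 - p 0) * X + (q 1 - p 1) * Y = A := by
      apply mul_right_cancel₀ h
      linear_combination (q 0 - p 0) * hX + (q 1 - p 1) * hY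
    linear_combination -2 * this + 2 * hA
  · have : (t 0 - p 0) * X + (t 1 - p 1) * Y = B := by
      apply mul_right_cancel₀ h
      linear_combination (t 0 - p 0) * hX + (t 1 - p 1) * hY
    linear_combination -2 * this + 2 * hB

theorem circumcenter_unique {p q t c c' : Plane} (h : cross p q t ≠ 0)
    (h1 : dist q c = dist p c) (h2 : dist t c = dist p c)
    (h1' : dist q c' = dist p c') (h2' : dist t c' = dist p c') : c = c' := by
  rw [← sq_eq_sq₀ dist_nonneg dist_nonneg, dist_sq, dist_sq] at h1 h2 h1' h2'
  have e1 : (q 0 - p 0) * (c 0 - c' 0) + (q 1 - p 1) * (c 1 - c' 1) = 0 := by linarith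
  have e2 : (t 0 - p 0) * (c 0 - c' 0) + (t 1 - p 1) * (c 1 - c' 1) = 0 := by linarith
  rw [cross] at h
  apply plane_ext <;> rw [← sub_eq_zero] <;> apply (mul_eq_zero.1 _).resolve_left h
  · linear_combination (t 1 - p 1) * e1 - (q 1 - p 1) * e2
  · linear_combination (q 0 - p 0) * e2 - (t 0 - p 0) * e1

theorem ne_of_cross_ne_zero {p q t : Plane} (h : cross p q t ≠ 0) : p ≠ q := by
  rintro rfl
  simp [cross] at h

/-- With barycentric weights `α, β, γ`, the difference `r² - |x - c|²` equals `αβ|p - q|² + βγ|q -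
t|² + γα|t - p|²`. -/
theorem dist_lt_of_mem_openTriangle {p q t c x : Plane} {r : ℝ} (hpq : p ≠ q)
    (hp : dist p c = r) (hq : dist q c = r) (ht : dist t c = r) (hx : x ∈ openTriangle p q t) :
    dist x c < r := by
  obtain ⟨α, β, γ, hα, hβ, hγ, hs, h0, h1⟩ := mem_openTriangle_iff.1 hx
  have hr : 0 ≤ r := hp ▸ dist_nonneg
  have hp2 := dist_sq p c
  have hq2 := dist_sq q c
  have ht2 := dist_sq t c
  rw [hp] at hp2
  rw [hq] at hq2
  rw [ht] at ht2
  rw [dist_lt_iff hr, h0, h1]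
  obtain rfl : γ = 1 - α - β := by linarith
  have key : 0 < α * β * dist p q ^ 2 + β * (1 - α - β) * dist q t ^ 2
      + (1 - α - β) * α * dist t p ^ 2 := by
    have := dist_pos.2 hpq
    positivity
  simp only [dist_sq] at key
  linear_combination key - α * hp2 - β * hq2 - (1 - α - β) * ht2

theorem convex_openTriangle (p q t : Plane) : Convex ℝ (openTriangle p q t) := by
  rintro x ⟨a, b, c, ha, hb, hc, h, rfl⟩ y ⟨a', b', c', ha', hb', hc', h', rfl⟩ u v hu hv huv
  have pos : ∀ {s s' : ℝ}, 0 < s → 0 < s' → 0 < u * s + v * s' := by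
    intro s s' hs hs'
    rcases hu.eq_or_lt with rfl | hu
    · obtain rfl : v = 1 := by linarith
      simpa
    · positivity
  refine ⟨u * a + v * a', u * b + v * b', u * c + v * c', pos ha ha', pos hb hb', pos hc hc',
    by linear_combination u * h + v * h' + huv, ?_⟩
  module

theorem openTriangle_nonempty (p q t : Plane) : (openTriangle p q t).Nonempty :=
  ⟨_, 1 / 3, 1 / 3, 1 / 3, by norm_num, by norm_num, by norm_num, by norm_num, rfl⟩

theorem openTriangle_subset (p q t : Plane) : openTriangle p q t ⊆ convexHull ℝ {p, q, t} := by
  rintro x ⟨a, b, c, ha, hb, hc, h, rfl⟩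
  have hsum := (convex_convexHull ℝ {p, q, t}).sum_mem (t := Finset.univ) (w := ![a, b, c])
    (z := ![p, q, t]) (by intro i _; fin_cases i <;> simp [ha.le, hb.le, hc.le])
    (by simpa [Fin.sum_univ_three] using h)
    (by intro i _; apply subset_convexHull; fin_cases i <;> simp)
  simpa [Fin.sum_univ_three] using hsum

theorem convexHull_triple_subset_closure (p q t : Plane) :
    convexHull ℝ {p, q, t} ⊆ closure (openTriangle p q t) := by
  apply convexHull_min _ (convex_openTriangle p q t).closure
  -- Each vertex is a limit of points pushed slightly towards the centroid.
  have key : ∀ y ∈ ({p, q, t} : Set Plane), ∀ ε : ℝ, 0 < ε → ε < 1 →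
      (1 - ε) • y + ε • ((1 / 3 : ℝ) • p + (1 / 3 : ℝ) • q + (1 / 3 : ℝ) • t) ∈
        openTriangle p q t := by
    rintro y hy ε h0 h1
    rcases hy with rfl | rfl | rfl
    · exact ⟨1 - ε + ε / 3, ε / 3, ε / 3, by linarith, by linarith, by linarith, by ring,
        by module⟩
    · exact ⟨ε / 3, 1 - ε + ε / 3, ε / 3, by linarith, by linarith, by linarith, by ring,
        by module⟩
    · exact ⟨ε / 3, ε / 3, 1 - ε + ε / 3, by linarith, by linarith, by linarith, by ring,
        by module⟩
  intro y hy
  set g := (1 / 3 : ℝ) • p + (1 / 3 : ℝ) • q + (1 / 3 : ℝ) • t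
  have hlim : Filter.Tendsto (fun ε : ℝ => (1 - ε) • y + ε • g) (nhdsWithin 0 (Set.Ioi 0))
      (nhds y) := by
    have : Continuous fun ε : ℝ => (1 - ε) • y + ε • g := by fun_prop
    simpa using (this.tendsto 0).mono_left nhdsWithin_le_nhds
  refine mem_closure_of_tendsto hlim ?_
  filter_upwards [Ioo_mem_nhdsGT (zero_lt_one (α := ℝ))] with ε hε
  exact key y hy ε hε.1 hε.2

theorem continuous_cross (p q : Plane) : Continuous (cross p q) := by
  unfold cross
  fun_prop

theorem isOpen_openTriangle {p q t : Plane} (h : cross p q t ≠ 0) :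
    IsOpen (openTriangle p q t) := by
  -- The barycentric coordinates are quotients of signed areas, hence continuous.
  have : openTriangle p q t = {x | 0 < cross p q x / cross p q t} ∩
      ({x | 0 < cross q t x / cross p q t} ∩ {x | 0 < cross t p x / cross p q t}) := by
    ext x
    rw [mem_openTriangle_iff]
    constructor
    · rintro ⟨a, b, c, ha, hb, hc, hs, h0, h1⟩
      obtain rfl : c = 1 - a - b := by linarith
      have e1 : cross p q x = (1 - a - b) * cross p q t := by
        simp only [cross, h0, h1]; ring
      have e2 : cross q t x = a * cross p q t := by
        simp only [cross, h0, h1]; ring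
      have e3 : cross t p x = b * cross p q t := by
        simp only [cross, h0, h1]; ring
      simp only [Set.mem_inter_iff, Set.mem_ofPred_eq, e1, e2, e3, mul_div_cancel_right₀ _ h]
      exact ⟨hc, ha, hb⟩
    · rintro ⟨hc, ha, hb⟩
      refine ⟨_, _, _, ha, hb, hc, ?_, ?_, ?_⟩
      all_goals
        field_simp
        simp only [cross]
        ring
  rw [this]
  have hc : ∀ a b, IsOpen {x | 0 < cross a b x / cross p q t} := fun a b =>
    isOpen_lt continuous_const ((continuous_cross a b).div_const _)
  exact (hc _ _).inter ((hc _ _).inter (hc _ _))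

/-! ### Generic points, and connected sets that avoid the frontier -/

/-- Every nonempty open set contains a point off finitely many given lines. -/
theorem exists_mem_forall_cross_ne_zero {S : Set Seg} (hS : S.Finite) {U : Set Plane}
    (hU : IsOpen U) (hne : U.Nonempty) :
    ∃ x ∈ U, ∀ e ∈ S, e.1 ≠ e.2 → cross e.1 e.2 x ≠ 0 := by
  induction S, hS using Set.Finite.induction_on generalizing U with
  | empty => exact ⟨hne.some, hne.some_mem, by simp⟩
  | @insert a S _ _ ih =>
    by_cases ha : a.1 = a.2
    · obtain ⟨x, hx, h⟩ := ih hU hne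
      refine ⟨x, hx, ?_⟩
      rintro e (rfl | he) hne
      · exact absurd ha hne
      · exact h e he hne
    · have hV : (U ∩ {x | cross a.1 a.2 x ≠ 0}).Nonempty := by
        obtain ⟨x, hx⟩ := hne
        -- A normal of the line: a small step along it leaves the line without leaving `U`.
        set n : Plane := !₂[-(a.2 1 - a.1 1), a.2 0 - a.1 0] with hn
        have hlim : Filter.Tendsto (fun ε : ℝ => x + ε • n) (nhds 0) (nhds x) := by
          have : Continuous fun ε : ℝ => x + ε • n := by fun_prop
          simpa using this.tendsto 0
        have hc : ∀ ε : ℝ, cross a.1 a.2 (x + ε • n) =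
            cross a.1 a.2 x + ε * dist a.2 a.1 ^ 2 := by
          intro ε
          rw [dist_sq]
          simp [cross, hn]
          ring
        have hd := dist_pos.2 (Ne.symm ha)
        by_cases h0 : cross a.1 a.2 x = 0
        · have : ∀ᶠ ε : ℝ in nhdsWithin 0 (Set.Ioi 0), x + ε • n ∈ U ∧ 0 < ε :=
            ((hlim.mono_left nhdsWithin_le_nhds).eventually (hU.mem_nhds hx)).and
              self_mem_nhdsWithin
          obtain ⟨ε, h1, h2⟩ := this.exists
          refine ⟨_, h1, ?_⟩
          rw [Set.mem_ofPred_eq, hc, h0]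
          positivity
        · exact ⟨x, hx, h0⟩
      obtain ⟨x, hx, h⟩ := ih (hU.inter (isOpen_ne_fun (continuous_cross _ _)
        continuous_const)) hV
      refine ⟨x, hx.1, ?_⟩
      rintro e (rfl | he) hne
      · exact hx.2
      · exact h e he hne

theorem subset_interior_of_disjoint_frontier {X : Type*} [TopologicalSpace X] {A s : Set X}
    (hs : IsPreconnected s) (hd : Disjoint s (frontier A)) (hne : (s ∩ A).Nonempty) :
    s ⊆ interior A := by
  have hnot : ∀ x ∈ s, x ∈ closure A → x ∈ interior A := fun x hx hxc => by
    by_contra hxi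
    exact Set.disjoint_left.1 hd hx ⟨hxc, hxi⟩
  refine hs.subset_left_of_subset_union isOpen_interior isClosed_closure.isOpen_compl
    (Set.disjoint_left.2 fun x hx hx' => hx' (subset_closure (interior_subset hx))) ?_ ?_
  · intro x hx
    by_cases hxc : x ∈ closure A
    · exact Or.inl (hnot x hx hxc)
    · exact Or.inr hxc
  · obtain ⟨x, hx, hxA⟩ := hne
    exact ⟨x, hx, hnot x hx (subset_closure hxA)⟩

/-! ### Diametral circles and empty circumcircles -/

/-- The segment runs from `(0, 0)` to `(N, 0)`; the circle has centre `(C₁, C₂)` and squared radius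
`R`. Since `(Z, 0)` is inside the circle and the endpoints are not, `C₁` lies over the segment; then
so does `X`, because `(X, Y)` is on the circle. The power of `(X, 0)` is `-Y² + 2YC₂ < -Y²`.
Interpolating the nonnegative powers of the endpoints bounds it below by `-X(N - X)`, which is at
least `-Y²` as `(X, Y)` is outside the diametral disc. -/
theorem center_side_aux {N X Y C₁ C₂ Z R : ℝ} (hN : 0 < N) (hYC : Y * C₂ < 0)
    (hp : (X - C₁) ^ 2 + (Y - C₂) ^ 2 = R) (ha : R ≤ C₁ ^ 2 + C₂ ^ 2)
    (hb : R ≤ (N - C₁) ^ 2 + C₂ ^ 2) (hd : 0 ≤ X * (X - N) + Y ^ 2) (hz0 : 0 ≤ Z) (hz1 : Z ≤ N)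
    (hz : (Z - C₁) ^ 2 + C₂ ^ 2 < R) : False := by
  have hC0 : 0 < C₁ := by
    by_contra! h
    nlinarith
  have hC1 : C₁ < N := by
    by_contra! h
    nlinarith
  have hX0 : 0 ≤ X := by
    by_contra! h
    nlinarith [sq_nonneg Y, mul_pos (neg_pos.2 h) hC0]
  have hX1 : X ≤ N := by
    by_contra! h
    nlinarith [sq_nonneg Y, mul_pos (sub_pos.2 h) (sub_pos.2 hC1)]
  nlinarith [mul_nonneg (sub_nonneg.2 hX1) (sub_nonneg.2 ha), mul_nonneg hX0 (sub_nonneg.2 hb),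
    mul_pos hN (neg_pos.2 hYC), mul_nonneg hN.le hd]

/-- If the diametral circle of `e` is empty, and so is the circumcircle of a triangle, then `e`
does not separate the triangle from its circumcentre. -/
theorem notMem_carrier_toward_circumcenter {e : Seg} {p q t c x : Plane} {r : ℝ}
    (he : e.1 ≠ e.2) (hp : dist p c = r) (hq : dist q c = r) (ht : dist t c = r) (hpq : p ≠ q)
    (ha : r ≤ dist e.1 c) (hb : r ≤ dist e.2 c) (hpe : p ∉ e.disc) (hqe : q ∉ e.disc)
    (hte : t ∉ e.disc) (hx : x ∈ openTriangle p q t) (hxe : cross e.1 e.2 x ≠ 0) {τ : ℝ}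
    (h0 : 0 ≤ τ) (h1 : τ < 1) : (1 - τ) • x + τ • c ∉ e.carrier := by
  intro hz
  have hr : 0 ≤ r := hp ▸ dist_nonneg
  have hxc := dist_lt_of_mem_openTriangle hpq hp hq ht hx
  set z := (1 - τ) • x + τ • c with hzdef
  have hz0 : z 0 = (1 - τ) * x 0 + τ * c 0 := by simp [hzdef]
  have hz1 : z 1 = (1 - τ) * x 1 + τ * c 1 := by simp [hzdef]
  have hzc : dist z c < r := by
    rw [dist_lt_iff hr] at hxc ⊢
    have : (z 0 - c 0) ^ 2 + (z 1 - c 1) ^ 2 =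
        (1 - τ) ^ 2 * ((x 0 - c 0) ^ 2 + (x 1 - c 1) ^ 2) := by rw [hz0, hz1]; ring
    rw [this]
    have h2 : (1 - τ) ^ 2 ≤ 1 := by nlinarith
    nlinarith [sq_nonneg (x 0 - c 0), sq_nonneg (x 1 - c 1)]
  have hline : (1 - τ) * cross e.1 e.2 x + τ * cross e.1 e.2 c = 0 := by
    rw [← cross_carrier hz]
    simp only [cross, hz0, hz1]
    ring
  have hτ : 0 < τ := by
    rcases h0.eq_or_lt with rfl | h
    · simp at hline
      exact absurd hline hxe
    · exact h
  -- A hit before the end would put `x` and `c` strictly on opposite sides of the line. Yet `key`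
  -- puts every vertex of the triangle weakly on the side of `c`, and hence also `x`.
  have hneg : cross e.1 e.2 x * cross e.1 e.2 c < 0 := by
    have : τ * (cross e.1 e.2 x * cross e.1 e.2 c) = -((1 - τ) * cross e.1 e.2 x ^ 2) := by
      linear_combination cross e.1 e.2 x * hline
    have h3 : 0 < (1 - τ) * cross e.1 e.2 x ^ 2 := by
      have := sub_pos.2 h1
      positivity
    nlinarith
  have key : ∀ y, dist y c = r → y ∉ e.disc → 0 ≤ cross e.1 e.2 y * cross e.1 e.2 c := by
    intro y hy hye
    by_contra! hlt
    obtain ⟨u, v, hu, hv, huv, hu0, hu1⟩ := mem_carrier_iff.1 hz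
    have hN : 0 < dist e.1 e.2 ^ 2 := pow_pos (dist_pos.2 he) 2
    have hv1 : v ≤ 1 := by linarith
    obtain rfl : u = 1 - v := by linarith
    rw [notMem_disc_iff, thales] at hye
    rw [le_dist_iff hr] at ha hb
    rw [dist_lt_iff hr] at hzc
    have hy2 := dist_sq y c
    rw [hy] at hy2
    set N := dist e.1 e.2 ^ 2 with hNdef
    rw [dist_sq] at hNdef
    -- Coordinates along and across `e` with origin `e.1`, scaled by the length of `e` to avoid
    -- square roots; therefore `e.2` becomes `(N, 0)`, where `N` is the squared length.
    refine center_side_aux (N := N) (C₂ := cross e.1 e.2 c) (Y := cross e.1 e.2 y)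
      (X := (e.2 0 - e.1 0) * (y 0 - e.1 0) + (e.2 1 - e.1 1) * (y 1 - e.1 1))
      (C₁ := (e.2 0 - e.1 0) * (c 0 - e.1 0) + (e.2 1 - e.1 1) * (c 1 - e.1 1))
      (Z := N * v) (R := N * r ^ 2) hN hlt ?_ ?_ ?_ ?_ (by positivity) (by nlinarith) ?_
    · rw [hNdef, hy2, cross, cross]
      ring
    · have := mul_le_mul_of_nonneg_left ha hN.le
      refine this.trans_eq ?_
      rw [hNdef, cross]
      ring
    · have := mul_le_mul_of_nonneg_left hb hN.le
      refine this.trans_eq ?_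
      rw [hNdef, cross]
      ring
    · have := mul_nonneg hN.le hye
      refine this.trans_eq ?_
      rw [hNdef, cross]
      ring
    · have := mul_lt_mul_of_pos_left hzc hN
      refine lt_of_eq_of_lt ?_ this
      rw [hu0, hu1, hNdef, cross]
      ring
  obtain ⟨α, β, γ, hα, hβ, hγ, hs, hx0, hx1⟩ := mem_openTriangle_iff.1 hx
  have hxs : cross e.1 e.2 x =
      α * cross e.1 e.2 p + β * cross e.1 e.2 q + γ * cross e.1 e.2 t := by
    obtain rfl : γ = 1 - α - β := by linarith
    simp only [cross, hx0, hx1]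
    ring
  rw [hxs] at hneg
  nlinarith [mul_nonneg hα.le (key p hp hpe), mul_nonneg hβ.le (key q hq hqe),
    mul_nonneg hγ.le (key t ht hte)]

/-- A segment with empty diametral circle that crosses a triangle with empty circumcircle is a
diameter of that circle. -/
theorem eq_of_mem_openTriangle_of_mem_carrier {e : Seg} {p q t c z : Plane} {r : ℝ}
    (hp : dist p c = r) (hq : dist q c = r) (ht : dist t c = r)
    (hpqt : cross p q t ≠ 0) (ha : r ≤ dist e.1 c) (hb : r ≤ dist e.2 c) (hpe : p ∉ e.disc)
    (hqe : q ∉ e.disc) (hte : t ∉ e.disc) (hz : z ∈ openTriangle p q t) (hze : z ∈ e.carrier) :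
    c = e.mid ∧ r = e.radius := by
  have hr : 0 ≤ r := hp ▸ dist_nonneg
  obtain ⟨α, β, γ, hα, hβ, hγ, hs, hx0, hx1⟩ := mem_openTriangle_iff.1 hz
  obtain ⟨u, v, hu, hv, huv, hu0, hu1⟩ := mem_carrier_iff.1 hze
  rw [notMem_disc_iff] at hpe hqe hte
  have ha' := (le_dist_iff hr).1 ha
  have hb' := (le_dist_iff hr).1 hb
  have hp2 := dist_sq p c
  have hq2 := dist_sq q c
  have ht2 := dist_sq t c
  rw [hp] at hp2
  rw [hq] at hq2
  rw [ht] at ht2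
  -- The powers with respect to the two circles differ by an affine function. Evaluate it at `z`
  -- twice: from `p, q, t`, where the power to the circumcircle vanishes, and from the endpoints of
  -- `e`, where `thales` vanishes and the other power is nonnegative. As each summand here is
  -- nonnegative, `p, q, t` all lie on the diametral circle.
  have hsum : α * thales e p + β * thales e q + γ * thales e t ≤ 0 := by
    have h1 : 0 ≤ u * ((e.1 0 - c 0) ^ 2 + (e.1 1 - c 1) ^ 2 - r ^ 2) :=
      mul_nonneg hu (by linarith)
    have h2 : 0 ≤ v * ((e.2 0 - c 0) ^ 2 + (e.2 1 - c 1) ^ 2 - r ^ 2) :=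
      mul_nonneg hv (by linarith)
    obtain rfl : γ = 1 - α - β := by linarith
    obtain rfl : u = 1 - v := by linarith
    have e0 := hx0.symm.trans hu0
    have e1 := hx1.symm.trans hu1
    simp only [thales]
    linear_combination h1 + h2 - α * hp2 - β * hq2 - (1 - α - β) * ht2
      + (2 * c 0 - e.1 0 - e.2 0) * e0 + (2 * c 1 - e.1 1 - e.2 1) * e1
  have tp : thales e p = 0 := by
    by_contra h
    have := mul_pos hα (hpe.lt_of_ne' h)
    linarith [mul_nonneg hβ.le hqe, mul_nonneg hγ.le hte]
  have tq : thales e q = 0 := by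
    by_contra h
    have := mul_pos hβ (hqe.lt_of_ne' h)
    linarith [mul_nonneg hα.le hpe, mul_nonneg hγ.le hte]
  have tt : thales e t = 0 := by
    by_contra h
    have := mul_pos hγ (hte.lt_of_ne' h)
    linarith [mul_nonneg hβ.le hqe, mul_nonneg hα.le hpe]
  have hd : ∀ y, thales e y = 0 → dist y e.mid = e.radius := by
    intro y hy
    rw [thales_eq, sub_eq_zero, sq_eq_sq₀ dist_nonneg e.radius_nonneg] at hy
    exact hy
  have hc : c = e.mid := circumcenter_unique hpqt (hq.trans hp.symm) (ht.trans hp.symm)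
    ((hd q tq).trans (hd p tp).symm) ((hd t tt).trans (hd p tp).symm)
  exact ⟨hc, by rw [← hp, hc, hd p tp]⟩

/-! ### Triangles with empty circumcircle -/

theorem exists_triple_of_mem_convexHull {P : Set Plane} {x : Plane} (hx : x ∈ convexHull ℝ P) :
    ∃ p ∈ P, ∃ q ∈ P, ∃ t ∈ P, ∃ a b c : ℝ, 0 ≤ a ∧ 0 ≤ b ∧ 0 ≤ c ∧ a + b + c = 1 ∧
      a • p + b • q + c • t = x := by
  rw [convexHull_eq_union] at hx
  simp only [Set.mem_iUnion] at hx
  obtain ⟨T, hTP, hT, hxT⟩ := hx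
  obtain ⟨w, hw, hw1, hwx⟩ := Finset.mem_convexHull'.1 hxT
  have hcard : T.card ≤ 3 := by
    have h1 := hT.card_le_finrank_succ
    have h2 := Submodule.finrank_le (vectorSpan ℝ (Set.range ((↑) : T → Plane)))
    rw [finrank_euclideanSpace_fin] at h2
    rw [Fintype.card_coe] at h1
    omega
  have h4 : T.card < 4 := by omega
  interval_cases h : T.card
  · rw [Finset.card_eq_zero] at h
    subst h
    simp at hw1
  · obtain ⟨p, rfl⟩ := Finset.card_eq_one.1 h
    simp only [Finset.sum_singleton] at hw1 hwx
    have hp : p ∈ P := hTP (by simp)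
    exact ⟨p, hp, p, hp, p, hp, 1, 0, 0, by simp, by simp, by simp, by simp, by
      rw [← hwx, hw1]; simp⟩
  · obtain ⟨p, q, hpq, rfl⟩ := Finset.card_eq_two.1 h
    rw [Finset.sum_pair hpq] at hw1 hwx
    have hp : p ∈ P := hTP (by simp)
    have hq : q ∈ P := hTP (by simp)
    exact ⟨p, hp, q, hq, q, hq, w p, w q, 0, hw _ (by simp), hw _ (by simp), le_rfl, by simpa, by
      simpa⟩
  · obtain ⟨p, q, t, hpq, hpt, hqt, rfl⟩ := Finset.card_eq_three.1 h
    rw [Finset.sum_insert (by simp [hpq, hpt]), Finset.sum_pair hqt, ← add_assoc] at hw1 hwx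
    exact ⟨p, hTP (by simp), q, hTP (by simp), t, hTP (by simp), w p, w q, w t, hw _ (by simp),
      hw _ (by simp), hw _ (by simp), hw1, hwx⟩

/-- Lifted to a paraboloid centred at `x`, the triples compete for the lowest point above `x`; the
minimum is attained by compactness. The minimal triple will span the Delaunay triangle. -/
theorem exists_minimal_triple {P : Set Plane} (hP : P.Finite) {x : Plane}
    (hx : x ∈ convexHull ℝ P) :
    ∃ p ∈ P, ∃ q ∈ P, ∃ t ∈ P, ∃ a b c : ℝ, 0 ≤ a ∧ 0 ≤ b ∧ 0 ≤ c ∧ a + b + c = 1 ∧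
      a • p + b • q + c • t = x ∧
      ∀ p' ∈ P, ∀ q' ∈ P, ∀ t' ∈ P, ∀ a' b' c' : ℝ, 0 ≤ a' → 0 ≤ b' → 0 ≤ c' →
        a' + b' + c' = 1 → a' • p' + b' • q' + c' • t' = x →
        a * dist p x ^ 2 + b * dist q x ^ 2 + c * dist t x ^ 2 ≤
          a' * dist p' x ^ 2 + b' * dist q' x ^ 2 + c' * dist t' x ^ 2 := by
  let I : Set ℝ := Set.Icc 0 1
  let K : Set ((Plane × Plane × Plane) × (ℝ × ℝ × ℝ)) :=
    ((P ×ˢ P ×ˢ P) ×ˢ (I ×ˢ I ×ˢ I)) ∩ ({k | k.2.1 + k.2.2.1 + k.2.2.2 = 1} ∩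
      {k | k.2.1 • k.1.1 + k.2.2.1 • k.1.2.1 + k.2.2.2 • k.1.2.2 = x})
  have hK : IsCompact K := by
    have hI : IsCompact I := isCompact_Icc
    have hPc := hP.isCompact
    refine ((hPc.prod (hPc.prod hPc)).prod (hI.prod (hI.prod hI))).inter_right ?_
    exact (isClosed_eq (by fun_prop) (by fun_prop)).inter
      (isClosed_eq (by fun_prop) (by fun_prop))
  have mk : ∀ p' ∈ P, ∀ q' ∈ P, ∀ t' ∈ P, ∀ a' b' c' : ℝ, 0 ≤ a' → 0 ≤ b' → 0 ≤ c' →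
      a' + b' + c' = 1 → a' • p' + b' • q' + c' • t' = x → ((p', q', t'), (a', b', c')) ∈ K :=
    fun p' hp' q' hq' t' ht' a' b' c' ha hb hc h hx' =>
      ⟨⟨⟨hp', hq', ht'⟩, ⟨ha, by linarith⟩, ⟨hb, by linarith⟩, ⟨hc, by linarith⟩⟩, h, hx'⟩
  have hne : K.Nonempty := by
    obtain ⟨p, hp, q, hq, t, ht, a, b, c, ha, hb, hc, h, hx'⟩ := exists_triple_of_mem_convexHull hx
    exact ⟨_, mk p hp q hq t ht a b c ha hb hc h hx'⟩
  have hcont : Continuous fun k : (Plane × Plane × Plane) × (ℝ × ℝ × ℝ) =>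
      k.2.1 * dist k.1.1 x ^ 2 + k.2.2.1 * dist k.1.2.1 x ^ 2 + k.2.2.2 * dist k.1.2.2 x ^ 2 := by
    fun_prop
  obtain ⟨⟨⟨p, q, t⟩, a, b, c⟩, ⟨⟨⟨hp, hq, ht⟩, ha, hb, hc⟩, h, hx'⟩, hmin⟩ :=
    hK.exists_isMinOn hne hcont.continuousOn
  exact ⟨p, hp, q, hq, t, ht, a, b, c, ha.1, hb.1, hc.1, h, hx',
    fun p' hp' q' hq' t' ht' a' b' c' ha hb hc h hx' =>
      hmin (mk p' hp' q' hq' t' ht' a' b' c' ha hb hc h hx')⟩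

/-- The ratio test of the simplex method: `θ` grows until the first weight vanishes, at the inverse
of the largest ratio. That ratio is positive since `u, v, w` sum to `1`. -/
theorem exists_pivot {a b c u v w : ℝ} (ha : 0 < a) (hb : 0 < b) (hc : 0 < c)
    (h : u + v + w = 1) : ∃ θ : ℝ, 0 < θ ∧ 0 ≤ a - θ * u ∧ 0 ≤ b - θ * v ∧ 0 ≤ c - θ * w ∧
      (a - θ * u = 0 ∨ b - θ * v = 0 ∨ c - θ * w = 0) := by
  have hM : 0 < max (u / a) (max (v / b) (w / c)) := by
    by_contra! hle
    simp only [max_le_iff] at hle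
    have h1 : u ≤ 0 := by simpa using (div_le_iff₀ ha).1 hle.1
    have h2 : v ≤ 0 := by simpa using (div_le_iff₀ hb).1 hle.2.1
    have h3 : w ≤ 0 := by simpa using (div_le_iff₀ hc).1 hle.2.2
    linarith
  set m := max (u / a) (max (v / b) (w / c)) with hm
  have h1 : u ≤ m * a := (div_le_iff₀ ha).1 (le_max_left _ _)
  have h2 : v ≤ m * b := (div_le_iff₀ hb).1 ((le_max_left _ _).trans (le_max_right _ _))
  have h3 : w ≤ m * c := (div_le_iff₀ hc).1 ((le_max_right _ _).trans (le_max_right _ _))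
  have key : ∀ s z : ℝ, z ≤ m * s → 0 ≤ s - 1 / m * z := by
    intro s z hz
    rw [sub_nonneg, one_div, inv_mul_le_iff₀ hM]
    exact hz
  have key' : ∀ s z : ℝ, 0 < s → m = z / s → s - 1 / m * z = 0 := by
    intro s z hs hz
    have : z = m * s := by rw [hz]; field_simp
    rw [this]
    field_simp
    ring
  refine ⟨1 / m, by positivity, key _ _ h1, key _ _ h2, key _ _ h3, ?_⟩
  rcases max_choice (u / a) (max (v / b) (w / c)) with h4 | h4
  · exact Or.inl (key' _ _ ha (hm.trans h4))
  · rcases max_choice (v / b) (w / c) with h5 | h5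
    · exact Or.inr (Or.inl (key' _ _ hb (hm.trans (h4.trans h5))))
    · exact Or.inr (Or.inr (key' _ _ hc (hm.trans (h4.trans h5))))

/-- A point of the convex hull of `P` in general position lies in a triangle of the Delaunay
triangulation of `P`. -/
theorem exists_empty_circumcircle {P : Set Plane} (hP : P.Finite) {x : Plane}
    (hx : x ∈ convexHull ℝ P) (hxP : x ∉ P)
    (hgen : ∀ p ∈ P, ∀ q ∈ P, p ≠ q → cross p q x ≠ 0) :
    ∃ p ∈ P, ∃ q ∈ P, ∃ t ∈ P, ∃ c : Plane, ∃ r : ℝ, cross p q t ≠ 0 ∧ x ∈ openTriangle p q t ∧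
      dist p c = r ∧ dist q c = r ∧ dist t c = r ∧ ∀ v ∈ P, r ≤ dist v c := by
  obtain ⟨p, hp, q, hq, t, ht, α, β, γ, hα, hβ, hγ, hs, hx', hmin⟩ := exists_minimal_triple hP hx
  have hline : ∀ p ∈ P, ∀ q ∈ P, ∀ a b : ℝ, a + b = 1 → a • p + b • q ≠ x := by
    rintro p hp q hq a b hab rfl
    rcases eq_or_ne p q with rfl | hpq
    · rw [← add_smul, hab, one_smul] at hxP
      exact hxP hp
    · apply hgen p hp q hq hpq
      obtain rfl : b = 1 - a := by linarith
      simp [cross]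
      ring
  have hα' : 0 < α := hα.lt_of_ne (by
    rintro rfl
    exact hline q hq t ht β γ (by linarith) (by simpa using hx'))
  have hβ' : 0 < β := hβ.lt_of_ne (by
    rintro rfl
    exact hline p hp t ht α γ (by linarith) (by simpa using hx'))
  have hγ' : 0 < γ := hγ.lt_of_ne (by
    rintro rfl
    exact hline p hp q hq α β (by linarith) (by simpa using hx'))
  have hx0 : x 0 = α * p 0 + β * q 0 + γ * t 0 := by simp [← hx']
  have hx1 : x 1 = α * p 1 + β * q 1 + γ * t 1 := by simp [← hx']
  have hpq : p ≠ q := by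
    rintro rfl
    exact hline p hp t ht (α + β) γ (by linarith) (by rw [← hx']; module)
  have hpqt : cross p q t ≠ 0 := by
    intro h0
    apply hgen p hp q hq hpq
    have : cross p q x = γ * cross p q t := by
      obtain rfl : γ = 1 - α - β := by linarith
      simp only [cross, hx0, hx1]
      ring
    rw [this, h0, mul_zero]
  obtain ⟨c, hcq, hct⟩ := exists_circumcenter hpqt
  refine ⟨p, hp, q, hq, t, ht, c, dist p c, hpqt, ⟨α, β, γ, hα', hβ', hγ', hs, hx'.symm⟩, rfl,
    hcq, hct, ?_⟩
  -- A vertex `v` inside the circumcircle could be pivoted into the minimal triple with weight `θ`.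
  by_contra! hv
  obtain ⟨v, hv, hvc⟩ := hv
  have e1 : cross q t v / cross p q t + cross t p v / cross p q t + cross p q v / cross p q t =
      1 := by
    field_simp
    simp only [cross]
    ring
  have ev : ∀ i : Fin 2, v i = cross q t v / cross p q t * p i + cross t p v / cross p q t * q i +
      cross p q v / cross p q t * t i := by
    intro i
    fin_cases i
    all_goals
      field_simp
      simp only [cross, Fin.zero_eta, Fin.mk_one]
      ring
  set u₁ := cross q t v / cross p q t
  set u₂ := cross t p v / cross p q t
  set u₃ := cross p q v / cross p q t
  obtain ⟨θ, hθ, h1, h2, h3, h0⟩ := exists_pivot hα' hβ' hγ' e1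
  have hcomb : θ • v + (α - θ * u₁) • p + (β - θ * u₂) • q + (γ - θ * u₃) • t = x := by
    apply plane_ext
    · simp only [PiLp.add_apply, PiLp.smul_apply, smul_eq_mul, hx0, ev 0]
      ring
    · simp only [PiLp.add_apply, PiLp.smul_apply, smul_eq_mul, hx1, ev 1]
      ring
  have hle : α * dist p x ^ 2 + β * dist q x ^ 2 + γ * dist t x ^ 2 ≤ θ * dist v x ^ 2 +
      (α - θ * u₁) * dist p x ^ 2 + (β - θ * u₂) * dist q x ^ 2 + (γ - θ * u₃) * dist t x ^ 2 := by
    rcases h0 with h0 | h0 | h0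
    · rw [h0] at hcomb ⊢
      have := hmin v hv q hq t ht θ _ _ hθ.le h2 h3 (by linear_combination hs - θ * e1 - h0)
        (by rw [← hcomb]; module)
      linarith
    · rw [h0] at hcomb ⊢
      have := hmin v hv p hp t ht θ _ _ hθ.le h1 h3 (by linear_combination hs - θ * e1 - h0)
        (by rw [← hcomb]; module)
      linarith
    · rw [h0] at hcomb ⊢
      have := hmin v hv p hp q hq θ _ _ hθ.le h1 h2 (by linear_combination hs - θ * e1 - h0)
        (by rw [← hcomb]; module)
      linarith
  have hq2 : dist q c ^ 2 = dist p c ^ 2 := by rw [hcq]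
  have ht2 : dist t c ^ 2 = dist p c ^ 2 := by rw [hct]
  have hv2 : dist v c ^ 2 < dist p c ^ 2 := by gcongr
  simp only [dist_sq] at hle hq2 ht2 hv2
  set dp := (p 0 - c 0) ^ 2 + (p 1 - c 1) ^ 2 with hdp
  set dv := (v 0 - c 0) ^ 2 + (v 1 - c 1) ^ 2 with hdv
  -- The squared distances to `x` and to `c` differ by an affine function, so `x` may be replaced by
  -- `c` in this affine relation. The pivot thus changes the cost by `θ * (dv - dp) < 0`, against
  -- minimality.
  have hAB : ((v 0 - x 0) ^ 2 + (v 1 - x 1) ^ 2) - u₁ * ((p 0 - x 0) ^ 2 + (p 1 - x 1) ^ 2) -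
      u₂ * ((q 0 - x 0) ^ 2 + (q 1 - x 1) ^ 2) - u₃ * ((t 0 - x 0) ^ 2 + (t 1 - x 1) ^ 2) =
      dv - dp := by
    linear_combination -2 * (x 0 - c 0) * ev 0 - 2 * (x 1 - c 1) * ev 1 -
      (x 0 ^ 2 - c 0 ^ 2 + x 1 ^ 2 - c 1 ^ 2 + dp) * e1 - u₂ * hq2 - u₃ * ht2 - hdv + u₁ * hdp
  have hcontra := mul_pos hθ (sub_pos.2 hv2)
  have h4 := congrArg (θ * ·) hAB
  simp only at h4
  linarith

/-! ### Delaunay triangles in a conforming drawing -/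

/-- A finite drawing in the region `Ω` whose segments cover the boundary of `Ω`. -/
structure Drawing.Fits (Ω : Set Plane) (D : Drawing) : Prop where
  isCompact : IsCompact Ω
  finite_verts : D.verts.Finite
  finite_segs : D.segs.Finite
  fst_mem : ∀ e ∈ D.segs, e.1 ∈ D.verts
  snd_mem : ∀ e ∈ D.segs, e.2 ∈ D.verts
  fst_ne_snd : ∀ e ∈ D.segs, e.1 ≠ e.2
  frontier_subset : frontier Ω ⊆ ⋃ e ∈ D.segs, e.carrier
  verts_subset : D.verts ⊆ Ω
  segs_subset : ∀ e ∈ D.segs, e.carrier ⊆ Ω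

/-- A drawing of the region `Ω` all of whose diametral discs contain no vertices and no points of
other segments. -/
structure Drawing.Conforming (Ω : Set Plane) (D : Drawing) : Prop extends Drawing.Fits Ω D where
  vert_notMem_disc : ∀ e ∈ D.segs, ∀ v ∈ D.verts, v ∉ e.disc
  disjoint_disc : ∀ e ∈ D.segs, ∀ f ∈ D.segs, e ≠ f → Disjoint e.disc f.carrier

variable {Ω : Set Plane} {D : Drawing}

theorem segs_nonempty_of_frontier_subset (hΩ : IsCompact Ω) (hne : Ω.Nonempty)
    (hfr : frontier Ω ⊆ ⋃ e ∈ D.segs, e.carrier) : D.segs.Nonempty := by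
  obtain ⟨x, hx⟩ := nonempty_frontier_iff.2 ⟨hne, fun h => noncompact_univ Plane (h ▸ hΩ)⟩
  obtain ⟨e, he, -⟩ := Set.mem_iUnion₂.1 (hfr hx)
  exact ⟨e, he⟩

theorem subset_interior_of_disjoint_segs (hfr : frontier Ω ⊆ ⋃ e ∈ D.segs, e.carrier)
    {s : Set Plane} (hs : Convex ℝ s) (hd : ∀ e ∈ D.segs, Disjoint s e.carrier)
    (hne : (s ∩ Ω).Nonempty) : s ⊆ interior Ω := by
  refine subset_interior_of_disjoint_frontier hs.isPreconnected ?_ hne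
  refine Disjoint.mono_right hfr ?_
  simpa only [Set.disjoint_iUnion_right] using hd

/-- A path can leave the interior only across the frontier, which the segments cover. The endpoint
itself may lie on a segment, hence the closure. -/
theorem mem_closure_interior_of_walk (hfr : frontier Ω ⊆ ⋃ e ∈ D.segs, e.carrier)
    {x c : Plane} (hx : x ∈ interior Ω)
    (hw : ∀ τ : ℝ, 0 ≤ τ → τ < 1 → ∀ e ∈ D.segs, (1 - τ) • x + τ • c ∉ e.carrier) :
    c ∈ closure (interior Ω) := by
  have hcont : Continuous fun τ : ℝ => (1 - τ) • x + τ • c := by fun_prop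
  have hsub : (fun τ : ℝ => (1 - τ) • x + τ • c) '' Set.Ico 0 1 ⊆ interior Ω := by
    refine subset_interior_of_disjoint_frontier
      (isPreconnected_Ico.image _ hcont.continuousOn) ?_
      ⟨x, ⟨0, by simp, by simp⟩, interior_subset hx⟩
    rw [Set.disjoint_left]
    rintro _ ⟨τ, hτ, rfl⟩ hfr'
    obtain ⟨e, he, h⟩ := Set.mem_iUnion₂.1 (hfr hfr')
    exact hw τ hτ.1 hτ.2 e he h
  have hlim : Filter.Tendsto (fun τ : ℝ => (1 - τ) • x + τ • c) (nhdsWithin 1 (Set.Iio 1))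
      (nhds c) := by
    simpa using (hcont.tendsto 1).mono_left nhdsWithin_le_nhds
  refine mem_closure_of_tendsto hlim ?_
  filter_upwards [Ico_mem_nhdsLT (zero_lt_one (α := ℝ))] with τ hτ
  exact hsub ⟨τ, hτ, rfl⟩

/-- Walk to the circumcentre from a point of the open triangle off all segment lines; by
`notMem_carrier_toward_circumcenter` no segment is met before the end. -/
theorem Drawing.Conforming.circumcenter_mem (hD : D.Conforming Ω) {p q t c : Plane} {r : ℝ}
    (h : IsDelaunayTriangle Ω D.verts p q t c r) : c ∈ closure (interior Ω) := by
  obtain ⟨hp, hq, ht, hind, hsub, hpc, hqc, htc, hemp⟩ := h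
  rw [affineIndependent_iff_cross_ne_zero] at hind
  have hopen := isOpen_openTriangle hind
  obtain ⟨x, hx, hgen⟩ := exists_mem_forall_cross_ne_zero hD.finite_segs hopen
    (openTriangle_nonempty p q t)
  refine mem_closure_interior_of_walk hD.frontier_subset
    (interior_maximal ((openTriangle_subset p q t).trans hsub) hopen hx) ?_
  intro τ h0 h1 e he
  have hne := hD.fst_ne_snd e he
  exact notMem_carrier_toward_circumcenter hne hpc hqc htc (ne_of_cross_ne_zero hind)
    (hemp _ (hD.fst_mem e he)) (hemp _ (hD.snd_mem e he)) (hD.vert_notMem_disc e he p hp)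
    (hD.vert_notMem_disc e he q hq) (hD.vert_notMem_disc e he t ht) hx (hgen e he hne) h0 h1

/-- Walk inside the disc, which other segments avoid, from a point off the line of `e`; that line is
reached only at the end. This gives access to midpoints of encroached segments only, as a segment
need not bound the interior of `Ω`. -/
theorem Drawing.Conforming.mid_mem (hD : D.Conforming Ω) {e : Seg} (he : e ∈ D.segs)
    {x : Plane} (hx : x ∈ closure (interior Ω)) (hxe : x ∈ e.disc) :
    e.mid ∈ closure (interior Ω) := by
  have hne := hD.fst_ne_snd e he
  have hopen : IsOpen e.disc := Metric.isOpen_ball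
  obtain ⟨y, hy, hgen⟩ := exists_mem_forall_cross_ne_zero (Set.finite_singleton e)
    (hopen.inter isOpen_interior) (mem_closure_iff.1 hx _ hopen hxe)
  have hcr := hgen e rfl hne
  refine mem_closure_interior_of_walk hD.frontier_subset hy.2 ?_
  intro τ h0 h1 f hf hz
  have hzd : (1 - τ) • y + τ • e.mid ∈ e.disc :=
    (convex_ball _ _) hy.1 (mid_mem_disc hne) (by linarith) h0 (by ring)
  rcases eq_or_ne e f with rfl | hef
  · have h2 := cross_carrier hz
    have h3 : cross e.1 e.2 ((1 - τ) • y + τ • e.mid) = (1 - τ) * cross e.1 e.2 y := by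
      simp only [cross, PiLp.add_apply, PiLp.smul_apply, smul_eq_mul, Seg.mid_apply]
      ring
    rw [h3] at h2
    rcases mul_eq_zero.1 h2 with h4 | h4
    · linarith
    · exact hcr h4
  · exact Set.disjoint_left.1 (hD.disjoint_disc e he f hf hef) hzd hz

/-- A separating nonzero functional attains its maximum over `Ω` on the frontier, hence on a segment
between vertices. -/
theorem Drawing.Conforming.subset_convexHull (hD : D.Conforming Ω) :
    Ω ⊆ convexHull ℝ D.verts := by
  intro y hy
  by_contra hyc
  obtain ⟨f, u, hu, huy⟩ := geometric_hahn_banach_closed_point (convex_convexHull ℝ D.verts)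
    (hD.finite_verts.isClosed_convexHull (𝕜 := ℝ)) hyc
  obtain ⟨z, hz, hmax⟩ := hD.isCompact.exists_isMaxOn ⟨y, hy⟩ f.continuous.continuousOn
  have hfz : u < f z := huy.trans_le (hmax hy)
  have hzi : z ∉ interior Ω := by
    intro hzi
    have hloc : IsLocalMax f z := by
      filter_upwards [mem_interior_iff_mem_nhds.1 hzi] with w hw using hmax hw
    have h0 : f = 0 := hloc.hasFDerivAt_eq_zero f.hasFDerivAt
    obtain ⟨e, he⟩ := segs_nonempty_of_frontier_subset hD.isCompact ⟨y, hy⟩ hD.frontier_subset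
    have h1 := hu e.1 (_root_.subset_convexHull ℝ _ (hD.fst_mem e he))
    simp only [h0, zero_apply] at h1 hfz
    linarith
  obtain ⟨e, he, hze⟩ := Set.mem_iUnion₂.1
    (hD.frontier_subset ⟨subset_closure hz, hzi⟩)
  have : z ∈ convexHull ℝ D.verts := by
    rw [Seg.carrier, ← convexHull_pair] at hze
    refine convexHull_mono ?_ hze
    rintro v (rfl | rfl)
    · exact hD.fst_mem e he
    · exact hD.snd_mem e he
  exact absurd (hu z this) hfz.not_gt

theorem Drawing.Conforming.triangle_subset (hD : D.Conforming Ω) {p q t x : Plane}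
    (hd : ∀ e ∈ D.segs, Disjoint (openTriangle p q t) e.carrier)
    (hx : x ∈ openTriangle p q t) (hxΩ : x ∈ Ω) : convexHull ℝ {p, q, t} ⊆ Ω :=
  (convexHull_triple_subset_closure p q t).trans (closure_minimal
    ((subset_interior_of_disjoint_segs hD.frontier_subset (convex_openTriangle p q t) hd
      ⟨x, hx, hxΩ⟩).trans interior_subset) hD.isCompact.isClosed)

/-- A triangle with empty circumcircle that contains an interior point of `Ω` has the circumcircle
of some Delaunay triangle that lies in `Ω`. -/
theorem Drawing.Conforming.exists_delaunayTriangle (hD : D.Conforming Ω) {p q t x c : Plane}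
    {r : ℝ} (hp : p ∈ D.verts) (hq : q ∈ D.verts) (ht : t ∈ D.verts) (hpqt : cross p q t ≠ 0)
    (hx : x ∈ openTriangle p q t) (hpc : dist p c = r) (hqc : dist q c = r) (htc : dist t c = r)
    (hemp : ∀ v ∈ D.verts, r ≤ dist v c) (hxΩ : x ∈ Ω)
    (hgen : ∀ e ∈ D.segs, cross e.1 e.2 x ≠ 0) :
    ∃ p q t, IsDelaunayTriangle Ω D.verts p q t c r := by
  have hdiam : ∀ p ∈ D.verts, ∀ q ∈ D.verts, ∀ t ∈ D.verts, cross p q t ≠ 0 → dist p c = r →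
      dist q c = r → dist t c = r → ∀ e ∈ D.segs, ∀ z ∈ openTriangle p q t, z ∈ e.carrier →
      c = e.mid ∧ r = e.radius := by
    intro p hp q hq t ht hpqt hpc hqc htc e he z hz hze
    exact eq_of_mem_openTriangle_of_mem_carrier hpc hqc htc hpqt (hemp _ (hD.fst_mem e he))
      (hemp _ (hD.snd_mem e he)) (hD.vert_notMem_disc e he p hp) (hD.vert_notMem_disc e he q hq)
      (hD.vert_notMem_disc e he t ht) hz hze
  -- A segment crosses the triangle only in a cocircular case, as a diameter of the circumcircle.
  -- Only one segment can have its midpoint at `c`. The triangle is then exchanged for another with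
  -- the same circumcircle and `e` as a side.
  by_cases hcross : ∃ e ∈ D.segs, ∃ z ∈ openTriangle p q t, z ∈ e.carrier
  · obtain ⟨e, he, z, hz, hze⟩ := hcross
    have hne := hD.fst_ne_snd e he
    obtain ⟨hce, hre⟩ := hdiam p hp q hq t ht hpqt hpc hqc htc e he z hz hze
    have huniq : ∀ f ∈ D.segs, c = f.mid → f = e := by
      intro f hf hcf
      by_contra hfe
      exact Set.disjoint_left.1 (hD.disjoint_disc e he f hf (Ne.symm hfe)) (mid_mem_disc hne)
        (hce ▸ hcf ▸ mid_mem_carrier f)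
    have h1c : dist e.1 c = r := by
      rw [hce, hre, Seg.mid, Seg.radius, dist_left_midpoint]
      norm_num
      ring
    have h2c : dist e.2 c = r := by
      rw [hce, hre, Seg.mid, Seg.radius, dist_right_midpoint]
      norm_num
      ring
    have hzc := dist_lt_of_mem_openTriangle (ne_of_cross_ne_zero hpqt) hpc hqc htc hz
    obtain ⟨a, b, ha, hb, hab, hz0, hz1⟩ := mem_carrier_iff.1 hze
    have ha' : 0 < a := ha.lt_of_ne (by
      rintro rfl
      obtain rfl : b = 1 := by linarith
      have : z = e.2 := plane_ext (by simpa using hz0) (by simpa using hz1)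
      rw [this, h2c] at hzc
      exact lt_irrefl _ hzc)
    have hb' : 0 < b := hb.lt_of_ne (by
      rintro rfl
      obtain rfl : a = 1 := by linarith
      have : z = e.1 := plane_ext (by simpa using hz0) (by simpa using hz1)
      rw [this, h1c] at hzc
      exact lt_irrefl _ hzc)
    -- As `x` is a convex combination of the vertices, one of them is strictly on its side of `e`.
    -- The midpoint of `z` and that vertex lies in both the old and the new triangle and is joined
    -- to `x` without crossing a segment.
    obtain ⟨p', hp', hp'c, hside, hmix⟩ : ∃ p' ∈ D.verts, dist p' c = r ∧
        0 < cross e.1 e.2 p' * cross e.1 e.2 x ∧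
        (1 / 2 : ℝ) • z + (1 / 2 : ℝ) • p' ∈ openTriangle p q t := by
      have hxx : 0 < cross e.1 e.2 x * cross e.1 e.2 x := mul_self_pos.2 (hgen e he)
      obtain ⟨α, β, γ, hα, hβ, hγ, hs, hx0, hx1⟩ := mem_openTriangle_iff.1 hx
      have hxs : cross e.1 e.2 x =
          α * cross e.1 e.2 p + β * cross e.1 e.2 q + γ * cross e.1 e.2 t := by
        obtain rfl : γ = 1 - α - β := by linarith
        simp only [cross, hx0, hx1]
        ring
      obtain ⟨α', β', γ', hα', hβ', hγ', hs', rfl⟩ := hz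
      by_contra! hcon
      have hp1 : cross e.1 e.2 p * cross e.1 e.2 x ≤ 0 := by
        by_contra! h
        exact hcon p hp hpc h ⟨α' / 2 + 1 / 2, β' / 2, γ' / 2, by linarith, by linarith,
          by linarith, by linarith, by module⟩
      have hq1 : cross e.1 e.2 q * cross e.1 e.2 x ≤ 0 := by
        by_contra! h
        exact hcon q hq hqc h ⟨α' / 2, β' / 2 + 1 / 2, γ' / 2, by linarith, by linarith,
          by linarith, by linarith, by module⟩
      have ht1 : cross e.1 e.2 t * cross e.1 e.2 x ≤ 0 := by
        by_contra! h
        exact hcon t ht htc h ⟨α' / 2, β' / 2, γ' / 2 + 1 / 2, by linarith, by linarith,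
          by linarith, by linarith, by module⟩
      have : cross e.1 e.2 x * cross e.1 e.2 x = α * (cross e.1 e.2 p * cross e.1 e.2 x) +
          β * (cross e.1 e.2 q * cross e.1 e.2 x) + γ * (cross e.1 e.2 t * cross e.1 e.2 x) := by
        linear_combination cross e.1 e.2 x * hxs
      linarith [mul_nonpos_of_nonneg_of_nonpos hα.le hp1,
        mul_nonpos_of_nonneg_of_nonpos hβ.le hq1, mul_nonpos_of_nonneg_of_nonpos hγ.le ht1]
    set y := (1 / 2 : ℝ) • z + (1 / 2 : ℝ) • p' with hy
    have hp'e : cross e.1 e.2 p' ≠ 0 := by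
      intro h
      simp [h] at hside
    have hye : y ∈ openTriangle e.1 e.2 p' := by
      refine mem_openTriangle_iff.2 ⟨a / 2, b / 2, 1 / 2, by linarith, by linarith, by norm_num,
        by linarith, ?_, ?_⟩
      · simp [hy, hz0]
        ring
      · simp [hy, hz1]
        ring
    have hyΩ : y ∈ Ω := by
      refine interior_subset (subset_interior_of_disjoint_segs hD.frontier_subset
        (convex_segment (𝕜 := ℝ) x y) ?_ ⟨x, left_mem_segment ℝ x y, hxΩ⟩
        (right_mem_segment ℝ x y))
      intro f hf
      rw [Set.disjoint_left]
      rintro w hw hwf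
      have hwT := (convex_openTriangle p q t).segment_subset hx hmix hw
      obtain rfl := huniq f hf (hdiam p hp q hq t ht hpqt hpc hqc htc f hf w hwT hwf).1
      have hw0 := cross_carrier hwf
      obtain ⟨u, v, hu, hv, huv, rfl⟩ := hw
      have : cross f.1 f.2 x * cross f.1 f.2 (u • x + v • y) =
          u * (cross f.1 f.2 x * cross f.1 f.2 x) +
          v / 2 * (cross f.1 f.2 p' * cross f.1 f.2 x) := by
        have hzc0 := cross_carrier hze
        obtain rfl : u = 1 - v := by linarith
        simp only [cross] at hzc0
        simp only [cross, hy, PiLp.add_apply, PiLp.smul_apply, smul_eq_mul]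
        linear_combination (v / 2) * ((f.2 0 - f.1 0) * (x 1 - f.1 1) -
          (f.2 1 - f.1 1) * (x 0 - f.1 0)) * hzc0
      rw [hw0, mul_zero] at this
      have hxx : 0 < cross f.1 f.2 x * cross f.1 f.2 x := mul_self_pos.2 (hgen f hf)
      rcases hu.eq_or_lt with rfl | hu'
      · obtain rfl : v = 1 := by linarith
        linarith
      · nlinarith
    refine ⟨e.1, e.2, p', hD.fst_mem e he, hD.snd_mem e he, hp',
      affineIndependent_iff_cross_ne_zero.2 hp'e, hD.triangle_subset ?_ hye hyΩ, h1c, h2c, hp'c,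
      hemp⟩
    intro f hf
    rw [Set.disjoint_left]
    intro w hw hwf
    obtain rfl := huniq f hf
      (hdiam e.1 (hD.fst_mem e he) e.2 (hD.snd_mem e he) p' hp' hp'e h1c h2c hp'c f hf w hw hwf).1
    obtain ⟨α, β, γ, -, -, hγ, hs, hw0, hw1⟩ := mem_openTriangle_iff.1 hw
    have : cross f.1 f.2 w = γ * cross f.1 f.2 p' := by
      obtain rfl : γ = 1 - α - β := by linarith
      simp only [cross, hw0, hw1]
      ring
    rw [cross_carrier hwf] at this
    exact mul_ne_zero hγ.ne' hp'e this.symm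
  · push Not at hcross
    exact ⟨p, q, t, hp, hq, ht, affineIndependent_iff_cross_ne_zero.2 hpqt,
      hD.triangle_subset (fun e he => Set.disjoint_left.2 (hcross e he)) hx hxΩ, hpc, hqc, htc,
      hemp⟩

/-- The barycentric average of the squared distances from `x` to the vertices is `r² - |x - c|²`. -/
theorem exists_vertex_dist_le {p q t c x : Plane} {r : ℝ} (hp : dist p c = r) (hq : dist q c = r)
    (ht : dist t c = r) (hx : x ∈ openTriangle p q t) :
    ∃ v ∈ ({p, q, t} : Set Plane), dist v x ≤ r := by
  obtain ⟨α, β, γ, hα, hβ, hγ, hs, h0, h1⟩ := mem_openTriangle_iff.1 hx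
  have hr : 0 ≤ r := hp ▸ dist_nonneg
  by_contra! hcon
  have h2 := (lt_dist_iff hr).1 (hcon p (by simp))
  have h3 := (lt_dist_iff hr).1 (hcon q (by simp))
  have h4 := (lt_dist_iff hr).1 (hcon t (by simp))
  have hp2 := dist_sq p c
  have hq2 := dist_sq q c
  have ht2 := dist_sq t c
  rw [hp] at hp2
  rw [hq] at hq2
  rw [ht] at ht2
  have h5 := sq_nonneg (x 0 - c 0)
  have h6 := sq_nonneg (x 1 - c 1)
  obtain rfl : γ = 1 - α - β := by linarith
  have key := add_pos (add_pos (mul_pos hα (sub_pos.2 h2)) (mul_pos hβ (sub_pos.2 h3)))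
    (mul_pos hγ (sub_pos.2 h4))
  have : (x 0 - c 0) ^ 2 + (x 1 - c 1) ^ 2 < 0 := by
    linear_combination key - α * hp2 - β * hq2 - (1 - α - β) * ht2 +
      2 * (x 0 - c 0) * h0 + 2 * (x 1 - c 1) * h1
  linarith

/-- Near every point of the closed region that is far from all vertices there is a large
circumcircle of a Delaunay triangle in the region. -/
theorem Drawing.Conforming.exists_poorCircle (hD : D.Conforming Ω) {x : Plane} {β ρ : ℝ}
    (hx : x ∈ closure (interior Ω)) (hρ : 0 ≤ ρ) (hfar : ∀ v ∈ D.verts, ρ < dist v x)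
    (hβ : β * shortestEdge Ω D.verts ≤ ρ) :
    ∃ a ∈ poorCircles β Ω D.verts, ρ < a.2 ∧ dist x a.1 ≤ 2 * a.2 := by
  -- `x` is moved to a generic interior point `y`. The first condition keeps it far from vertices;
  -- the second keeps `dist x y` below the new circumradius, which yields the factor `2`.
  have hopen : IsOpen (⋂ v ∈ D.verts, {y | ρ < dist v y ∧ dist x y < dist v y}) :=
    hD.finite_verts.isOpen_biInter fun v _ =>
      (isOpen_lt (by fun_prop) (by fun_prop)).and (isOpen_lt (by fun_prop) (by fun_prop))
  have hxU : x ∈ ⋂ v ∈ D.verts, {y | ρ < dist v y ∧ dist x y < dist v y} :=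
    Set.mem_iInter₂.2 fun v hv =>
      ⟨hfar v hv, by rw [dist_self]; exact hρ.trans_lt (hfar v hv)⟩
  obtain ⟨y, ⟨hyU, hyΩ⟩, hgen⟩ := exists_mem_forall_cross_ne_zero
    (hD.finite_verts.prod hD.finite_verts) (hopen.inter isOpen_interior)
    (mem_closure_iff.1 hx _ hopen hxU)
  rw [Set.mem_iInter₂] at hyU
  have hyP : y ∉ D.verts := fun h => by
    have := (hyU y h).2
    rw [dist_self] at this
    exact this.not_ge dist_nonneg
  obtain ⟨p, hp, q, hq, t, ht, c, r, hpqt, hyT, hpc, hqc, htc, hemp⟩ :=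
    exists_empty_circumcircle hD.finite_verts (hD.subset_convexHull (interior_subset hyΩ)) hyP
      fun p hp q hq hpq => hgen (p, q) ⟨hp, hq⟩ hpq
  obtain ⟨v, hv, hvy⟩ := exists_vertex_dist_le hpc hqc htc hyT
  have hvD : v ∈ D.verts := by
    rcases hv with rfl | rfl | rfl <;> assumption
  have hy := hyU v hvD
  have hyc := dist_lt_of_mem_openTriangle (ne_of_cross_ne_zero hpqt) hpc hqc htc hyT
  refine ⟨(c, r), ⟨hD.exists_delaunayTriangle hp hq ht hpqt hyT hpc hqc htc hemp
    (interior_subset hyΩ) fun e he => hgen e ⟨hD.fst_mem e he, hD.snd_mem e he⟩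
      (hD.fst_ne_snd e he), ?_⟩, ?_, ?_⟩
  · exact hβ.trans_lt (hy.1.trans_le hvy)
  · exact hy.1.trans_le hvy
  · have := dist_triangle x y c
    have := hy.2.trans_le hvy
    simp only
    linarith

/-! ### Splitting segments -/

/-- `h` is one of the two halves of the segment `e`. -/
def Seg.IsHalf (h e : Seg) : Prop := h = (e.1, e.mid) ∨ h = (e.mid, e.2)

theorem Seg.IsHalf.disc_subset {h e : Seg} (hh : h.IsHalf e) : h.disc ⊆ e.disc := by
  intro x hx
  rw [mem_disc_iff] at hx ⊢
  rcases hh with rfl | rfl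
  · simp only [thales, Seg.mid_apply] at hx ⊢
    nlinarith [sq_nonneg (x 0 - e.1 0), sq_nonneg (x 1 - e.1 1)]
  · simp only [thales, Seg.mid_apply] at hx ⊢
    nlinarith [sq_nonneg (x 0 - e.2 0), sq_nonneg (x 1 - e.2 1)]

theorem Seg.IsHalf.carrier_subset {h e : Seg} (hh : h.IsHalf e) : h.carrier ⊆ e.carrier := by
  rcases hh with rfl | rfl
  · exact (convex_segment _ _).segment_subset (fst_mem_carrier e) (mid_mem_carrier e)
  · exact (convex_segment _ _).segment_subset (mid_mem_carrier e) (snd_mem_carrier e)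

theorem Seg.IsHalf.disjoint {h h' e : Seg} (hh : h.IsHalf e) (hh' : h'.IsHalf e) (hne : h ≠ h') :
    Disjoint h.disc h'.carrier := by
  rw [Set.disjoint_left]
  intro x hx hx'
  rw [mem_disc_iff] at hx
  obtain ⟨a, b, ha, hb, hab, h0, h1⟩ := mem_carrier_iff.1 hx'
  rcases hh with rfl | rfl <;> rcases hh' with rfl | rfl
  · exact hne rfl
  · obtain rfl : a = 1 - b := by linarith
    have : thales (e.1, e.mid) x =
        b * (1 + b) * ((e.2 0 - e.1 0) ^ 2 + (e.2 1 - e.1 1) ^ 2) / 4 := by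
      simp only [thales, h0, h1, Seg.mid_apply]
      ring
    rw [this] at hx
    exact hx.not_ge (by positivity)
  · obtain rfl : b = 1 - a := by linarith
    have : thales (e.mid, e.2) x =
        a * (1 + a) * ((e.2 0 - e.1 0) ^ 2 + (e.2 1 - e.1 1) ^ 2) / 4 := by
      simp only [thales, h0, h1, Seg.mid_apply]
      ring
    rw [this] at hx
    exact hx.not_ge (by positivity)
  · exact hne rfl

theorem Seg.IsHalf.mid_notMem_disc {h e : Seg} (hh : h.IsHalf e) : e.mid ∉ h.disc := by
  rcases hh with rfl | rfl
  · exact snd_notMem_disc _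
  · exact fst_notMem_disc _

theorem Seg.IsHalf.radius_eq {h e : Seg} (hh : h.IsHalf e) : h.radius = e.radius / 2 := by
  rcases hh with rfl | rfl
  · simp [Seg.radius, Seg.mid]
    ring
  · simp [Seg.radius, Seg.mid]
    ring

theorem Seg.IsHalf.fst_ne_snd {h e : Seg} (hh : h.IsHalf e) (he : e.1 ≠ e.2) : h.1 ≠ h.2 := by
  rw [← dist_pos]
  have h1 := hh.radius_eq
  have h2 := Seg.radius_pos he
  unfold Seg.radius at h1 h2
  linarith

theorem carrier_subset_halves (e : Seg) :
    e.carrier ⊆ Seg.carrier (e.1, e.mid) ∪ Seg.carrier (e.mid, e.2) := by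
  intro x hx
  obtain ⟨a, b, ha, hb, hab, h0, h1⟩ := mem_carrier_iff.1 hx
  obtain rfl : a = 1 - b := by linarith
  rcases le_total b (1 / 2) with h | h
  · left
    refine mem_carrier_iff.2 ⟨1 - 2 * b, 2 * b, by linarith, by linarith, by ring, ?_, ?_⟩
    · simp only [h0, Seg.mid_apply]
      ring
    · simp only [h1, Seg.mid_apply]
      ring
  · right
    refine mem_carrier_iff.2 ⟨2 * (1 - b), 2 * b - 1, by linarith, by linarith, by ring, ?_, ?_⟩
    · simp only [h0, Seg.mid_apply]
      ring
    · simp only [h1, Seg.mid_apply]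
      ring

theorem mem_insertAll_segs {I : Set Candidate} {h : Seg} : h ∈ (D.insertAll I).segs ↔
    (h ∈ D.segs ∧ Sum.inr h ∉ I) ∨ ∃ e ∈ D.segs, Sum.inr e ∈ I ∧ h.IsHalf e := Iff.rfl

theorem mem_insertAll_verts {I : Set Candidate} {v : Plane} : v ∈ (D.insertAll I).verts ↔
    v ∈ D.verts ∨ ∃ k ∈ I, k.center = v := Iff.rfl

theorem Drawing.Fits.insertAll (hD : D.Fits Ω) {I : Set Candidate} (hI : I.Finite)
    (hIΩ : ∀ k ∈ I, k.center ∈ Ω) : (D.insertAll I).Fits Ω where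
  isCompact := hD.isCompact
  finite_verts := hD.finite_verts.union (hI.image _)
  finite_segs := by
    refine ((hD.finite_segs.union (hD.finite_segs.image fun e => ((e.1, e.mid) : Seg))).union
      (hD.finite_segs.image fun e => ((e.mid, e.2) : Seg))).subset ?_
    intro h hh
    rcases mem_insertAll_segs.1 hh with ⟨h1, -⟩ | ⟨e, he, -, rfl | rfl⟩
    · exact Or.inl (Or.inl h1)
    · exact Or.inl (Or.inr ⟨e, he, rfl⟩)
    · exact Or.inr ⟨e, he, rfl⟩
  fst_mem h hh := by
    rcases mem_insertAll_segs.1 hh with ⟨h1, -⟩ | ⟨e, he, hI, rfl | rfl⟩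
    · exact Or.inl (hD.fst_mem h h1)
    · exact Or.inl (hD.fst_mem e he)
    · exact Or.inr ⟨_, hI, rfl⟩
  snd_mem h hh := by
    rcases mem_insertAll_segs.1 hh with ⟨h1, -⟩ | ⟨e, he, hI, rfl | rfl⟩
    · exact Or.inl (hD.snd_mem h h1)
    · exact Or.inr ⟨_, hI, rfl⟩
    · exact Or.inl (hD.snd_mem e he)
  fst_ne_snd h hh := by
    rcases mem_insertAll_segs.1 hh with ⟨h1, -⟩ | ⟨e, he, -, hh⟩
    · exact hD.fst_ne_snd h h1
    · exact hh.fst_ne_snd (hD.fst_ne_snd e he)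
  frontier_subset := by
    intro x hx
    obtain ⟨e, he, hxe⟩ := Set.mem_iUnion₂.1 (hD.frontier_subset hx)
    rw [Set.mem_iUnion₂]
    by_cases hI : Sum.inr e ∈ I
    · rcases carrier_subset_halves e hxe with h | h
      · exact ⟨_, mem_insertAll_segs.2 (Or.inr ⟨e, he, hI, Or.inl rfl⟩), h⟩
      · exact ⟨_, mem_insertAll_segs.2 (Or.inr ⟨e, he, hI, Or.inr rfl⟩), h⟩
    · exact ⟨e, Or.inl ⟨he, hI⟩, hxe⟩
  verts_subset := by
    rintro v (hv | ⟨k, hk, rfl⟩)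
    · exact hD.verts_subset hv
    · exact hIΩ k hk
  segs_subset h hh := by
    rcases mem_insertAll_segs.1 hh with ⟨h1, -⟩ | ⟨e, he, -, hh⟩
    · exact hD.segs_subset h h1
    · exact hh.carrier_subset.trans (hD.segs_subset e he)

theorem Drawing.Conforming.mid_notMem_disc (hD : D.Conforming Ω) {e f : Seg} (he : e ∈ D.segs)
    (hf : f ∈ D.segs) (hef : e ≠ f) : f.mid ∉ e.disc := fun h =>
  Set.disjoint_left.1 (hD.disjoint_disc e he f hf hef) h (mid_mem_carrier f)

/-- Inserted circumcentres encroach nothing, and an inserted midpoint lies in the disc of its own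
segment only. That segment is replaced by halves, whose discs lie in the parent disc and miss the
midpoint. -/
theorem Drawing.Conforming.insertAll (hD : D.Conforming Ω) {I : Set Candidate} (hI : I.Finite)
    (hIΩ : ∀ k ∈ I, k.center ∈ Ω) (hseg : ∀ e, Sum.inr e ∈ I → e ∈ D.segs)
    (hfree : ∀ c, Sum.inl c ∈ I → ¬ D.Encroaches c.1) : (D.insertAll I).Conforming Ω where
  toFits := hD.toFits.insertAll hI hIΩ
  vert_notMem_disc := by
    have key : ∀ e ∈ D.segs, ∀ v ∈ (D.insertAll I).verts, v ∈ e.disc →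
        Sum.inr e ∈ I ∧ v = e.mid := by
      rintro e he v (hv | ⟨k, hk, rfl⟩) hve
      · exact absurd hve (hD.vert_notMem_disc e he v hv)
      · rcases k with c | f
        · exact absurd ⟨e, he, hve⟩ (hfree c hk)
        · by_cases hef : e = f
          · subst hef
            exact ⟨hk, rfl⟩
          · exact absurd hve (hD.mid_notMem_disc he (hseg f hk) hef)
    intro h hh v hv hvh
    rcases mem_insertAll_segs.1 hh with ⟨h1, h2⟩ | ⟨e, he, -, hh⟩
    · exact h2 (key h h1 v hv hvh).1
    · obtain ⟨-, rfl⟩ := key e he v hv (hh.disc_subset hvh)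
      exact hh.mid_notMem_disc hvh
  disjoint_disc := by
    intro h hh h' hh' hne
    rcases mem_insertAll_segs.1 hh with ⟨h1, h2⟩ | ⟨e, he, hI, hhe⟩ <;>
    rcases mem_insertAll_segs.1 hh' with ⟨h1', h2'⟩ | ⟨e', he', hI', hhe'⟩
    · exact hD.disjoint_disc h h1 h' h1' hne
    · refine (hD.disjoint_disc h h1 e' he' ?_).mono_right hhe'.carrier_subset
      rintro rfl
      exact h2 hI'
    · refine (hD.disjoint_disc e he h' h1' ?_).mono_left hhe.disc_subset
      rintro rfl
      exact h2' hI
    · by_cases hee : e = e'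
      · subst hee
        exact hhe.disjoint hhe' hne
      · exact (hD.disjoint_disc e he e' he' hee).mono hhe.disc_subset hhe'.carrier_subset

/-! ### Poor circumcircles and the shortest edge -/

variable {β : ℝ}

theorem shortestEdge_nonneg (Ω P : Set Plane) : 0 ≤ shortestEdge Ω P := by
  refine Real.sInf_nonneg ?_
  rintro l ⟨p, q, -, rfl⟩
  exact dist_nonneg

theorem shortestEdge_le {P : Set Plane} {p q : Plane} (h : IsDelaunayEdge Ω P p q) :
    shortestEdge Ω P ≤ dist p q := by
  refine csInf_le ⟨0, ?_⟩ ⟨p, q, h, rfl⟩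
  rintro l ⟨p, q, -, rfl⟩
  exact dist_nonneg

theorem exists_delaunayEdge {P : Set Plane} (h : (poorCircles β Ω P).Nonempty) :
    ∃ p q, IsDelaunayEdge Ω P p q := by
  obtain ⟨c, ⟨p, q, t, hp, hq, ht, hind, hsub, hpc, hqc, htc, hemp⟩, -⟩ := h
  refine ⟨p, q, hp, hq, ne_of_cross_ne_zero (affineIndependent_iff_cross_ne_zero.1 hind), ?_,
    c.1, hpc.trans hqc.symm, fun v hv => hpc.trans_le (hemp v hv)⟩
  refine ((convex_convexHull ℝ _).segment_subset ?_ ?_).trans hsub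
  · exact subset_convexHull ℝ _ (by simp)
  · exact subset_convexHull ℝ _ (by simp)

theorem le_shortestEdge {P : Set Plane} {l : ℝ} (h : (poorCircles β Ω P).Nonempty)
    (hl : ∀ p q, IsDelaunayEdge Ω P p q → l ≤ dist p q) : l ≤ shortestEdge Ω P := by
  obtain ⟨p, q, hpq⟩ := exists_delaunayEdge h
  refine le_csInf ⟨_, p, q, hpq, rfl⟩ ?_
  rintro _ ⟨p, q, hpq, rfl⟩
  exact hl p q hpq

theorem le_dist_of_mem_poorCircles {P : Set Plane} {c : Plane × ℝ} (hc : c ∈ poorCircles β Ω P)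
    {v : Plane} (hv : v ∈ P) : c.2 ≤ dist v c.1 := by
  obtain ⟨⟨p, q, t, -, -, -, -, -, -, -, -, hemp⟩, -⟩ := hc
  exact hemp v hv

theorem exists_dist_eq_of_mem_poorCircles {P : Set Plane} {c : Plane × ℝ}
    (hc : c ∈ poorCircles β Ω P) : ∃ v ∈ P, dist v c.1 = c.2 := by
  obtain ⟨⟨p, q, t, hp, -, -, -, -, hpc, -⟩, -⟩ := hc
  exact ⟨p, hp, hpc⟩

theorem finite_poorCircles {P : Set Plane} (hP : P.Finite) : (poorCircles β Ω P).Finite := by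
  have hS : ∀ k : Plane × Plane × Plane,
      {c : Plane × ℝ | IsDelaunayTriangle Ω P k.1 k.2.1 k.2.2 c.1 c.2}.Subsingleton := by
    rintro ⟨p, q, t⟩ ⟨c, r⟩ ⟨hp, hq, ht, hind, hsub, hpc, hqc, htc, hemp⟩ ⟨c', r'⟩
      ⟨-, -, -, -, -, hpc', hqc', htc', -⟩
    rw [affineIndependent_iff_cross_ne_zero] at hind
    simp only at hpc hqc htc hpc' hqc' htc'
    obtain rfl := circumcenter_unique hind (hqc.trans hpc.symm) (htc.trans hpc.symm)
      (hqc'.trans hpc'.symm) (htc'.trans hpc'.symm)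
    rw [← hpc, ← hpc']
  refine ((hP.prod (hP.prod hP)).biUnion fun k _ => (hS k).finite).subset ?_
  rintro c ⟨⟨p, q, t, h⟩, -⟩
  exact Set.mem_iUnion₂.2 ⟨(p, q, t), ⟨h.1, h.2.1, h.2.2.1⟩, h⟩

theorem shortestEdge_lt_of_mem_poorCircles {P : Set Plane} {c : Plane × ℝ} (hβ : √2 ≤ β)
    (hc : c ∈ poorCircles β Ω P) : shortestEdge Ω P < c.2 := by
  have h1 : 1 ≤ √2 := Real.one_le_sqrt.2 (by norm_num)
  nlinarith [hc.2, shortestEdge_nonneg Ω P]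

/-- The diametral circle of an encroached segment is not much smaller than the empty circle whose
centre encroaches it. -/
theorem lt_sqrt_two_mul_radius {d : Seg} {c : Plane} {r : ℝ} (hc : c ∈ d.disc)
    (h1 : r ≤ dist d.1 c) (h2 : r ≤ dist d.2 c) : r < √2 * d.radius := by
  by_contra! h
  have hr : 0 ≤ r := le_trans (mul_nonneg (Real.sqrt_nonneg 2) d.radius_nonneg) h
  rw [mem_disc_iff, thales] at hc
  rw [le_dist_iff hr] at h1 h2
  have h3 : 2 * d.radius ^ 2 ≤ r ^ 2 := by
    have := pow_le_pow_left₀ (mul_nonneg (Real.sqrt_nonneg 2) d.radius_nonneg) h 2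
    rwa [mul_pow, Real.sq_sqrt (by norm_num)] at this
  rw [d.radius_sq] at h3
  -- The squared distances from `c` to the two endpoints sum to `2|c - d.mid|² + 2 * d.radius²`,
  -- which is less than `4 * d.radius²`.
  nlinarith

/-! ### One iteration of the refinement -/

theorem Conflict.symm {a b : Candidate} (h : Conflict a b) : Conflict b a := by
  rcases a with a | a <;> rcases b with b | b
  · exact ⟨by rw [dist_comm]; exact h.2, by rw [dist_comm]; exact h.1⟩
  · exact h
  · exact h
  · exact h

theorem IsMaximalIndependent.exists_conflict {K I : Set Candidate} (h : IsMaximalIndependent K I)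
    {a : Candidate} (ha : a ∈ K) (haI : a ∉ I) : ∃ b ∈ I, Conflict a b := by
  by_contra! hcon
  refine haI (h.2 (y := insert a I) ⟨Set.insert_subset ha h.1.1, ?_⟩ (Set.subset_insert a I)
    (Set.mem_insert a I))
  refine h.1.2.insert fun b hb _ => ⟨hcon b hb, fun hba => hcon b hb hba.symm⟩

theorem exists_isMaximalIndependent {K J : Set Candidate} (hJ : J ⊆ K)
    (hJp : J.Pairwise fun a b => ¬ Conflict a b) : ∃ I, J ⊆ I ∧ IsMaximalIndependent K I := by
  obtain ⟨I, hJI, hI⟩ := zorn_subset_nonempty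
    {J : Set Candidate | J ⊆ K ∧ J.Pairwise fun a b => ¬ Conflict a b} (by
      intro c hc hchain hne
      refine ⟨⋃₀ c, ⟨Set.sUnion_subset fun s hs => (hc hs).1, ?_⟩, fun s hs =>
        Set.subset_sUnion_of_mem hs⟩
      exact (Set.pairwise_sUnion hchain.directedOn).2 fun s hs => (hc hs).2) J ⟨hJ, hJp⟩
  exact ⟨I, hJI, hI⟩

theorem exists_refineStep (h : (poorCircles β Ω D.verts).Nonempty) :
    ∃ D', RefineStep β Ω D D' := by
  obtain ⟨BC, -, hBC⟩ := exists_isMaximalIndependent (K := D.setB β Ω ∪ D.setC β Ω) (J := ∅)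
    (Set.empty_subset _) (Set.pairwise_empty _)
  have hD : (D.setD BC).Pairwise fun a b => ¬ Conflict a b := by
    rintro _ ⟨e, -, rfl⟩ _ ⟨f, -, rfl⟩ - h
    exact h
  obtain ⟨I, hDI, hI⟩ := exists_isMaximalIndependent
    (K := (BC ∩ D.setC β Ω) ∪ D.setD BC) Set.subset_union_right hD
  refine ⟨_, BC, I, hBC, ?_, hI, hDI, rfl⟩
  obtain ⟨b, hb⟩ : BC.Nonempty := by
    by_contra hne
    rw [Set.not_nonempty_iff_eq_empty] at hne
    obtain ⟨c, hc⟩ := h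
    have hcK : Sum.inl c ∈ D.setB β Ω ∪ D.setC β Ω := by
      by_cases hE : D.Encroaches c.1
      · exact Or.inl ⟨c, ⟨hc, hE⟩, rfl⟩
      · exact Or.inr ⟨c, ⟨hc, hE⟩, rfl⟩
    obtain ⟨b, hb, -⟩ := hBC.exists_conflict hcK (by simp [hne])
    simp [hne] at hb
  rcases hBC.1.1 hb with ⟨c, ⟨hc, e, he, hce⟩, rfl⟩ | hC
  · exact ⟨Sum.inr e, Or.inr ⟨e, ⟨he, _, hb, hce⟩, rfl⟩⟩
  · exact ⟨b, Or.inl ⟨hb, hC⟩⟩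

/-- The data of one iteration of the refinement loop. -/
structure StepData (β : ℝ) (Ω : Set Plane) (D : Drawing) (BC I : Set Candidate) : Prop where
  maximal_BC : IsMaximalIndependent (D.setB β Ω ∪ D.setC β Ω) BC
  nonempty : ((BC ∩ D.setC β Ω) ∪ D.setD BC).Nonempty
  maximal_I : IsMaximalIndependent ((BC ∩ D.setC β Ω) ∪ D.setD BC) I
  setD_subset : D.setD BC ⊆ I

variable {BC I : Set Candidate}

namespace StepData

theorem exists_of_mem_BC (hS : StepData β Ω D BC I) {a : Candidate} (ha : a ∈ BC) :
    ∃ c ∈ poorCircles β Ω D.verts, a = Sum.inl c := by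
  rcases hS.maximal_BC.1.1 ha with ⟨c, hc, rfl⟩ | ⟨c, hc, rfl⟩
  · exact ⟨c, hc.1, rfl⟩
  · exact ⟨c, hc.1, rfl⟩

theorem exists_of_inr_mem (hS : StepData β Ω D BC I) {d : Seg} (hd : Sum.inr d ∈ I) :
    d ∈ D.segs ∧ ∃ b ∈ poorCircles β Ω D.verts, b.1 ∈ d.disc := by
  rcases hS.maximal_I.1.1 hd with ⟨hBC, -⟩ | ⟨e, ⟨he, a, ha, hae⟩, h⟩
  · obtain ⟨c, -, h⟩ := hS.exists_of_mem_BC hBC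
    simp at h
  · obtain rfl : e = d := Sum.inr_injective h
    obtain ⟨c, hc, rfl⟩ := hS.exists_of_mem_BC ha
    exact ⟨he, c, hc, hae⟩

theorem of_inl_mem (hS : StepData β Ω D BC I) {c : Plane × ℝ} (hc : Sum.inl c ∈ I) :
    c ∈ poorCircles β Ω D.verts ∧ ¬ D.Encroaches c.1 ∧ Sum.inl c ∈ BC := by
  rcases hS.maximal_I.1.1 hc with ⟨hBC, c', hc', h⟩ | ⟨e, -, h⟩
  · obtain rfl : c' = c := Sum.inl_injective h
    exact ⟨hc'.1, hc'.2, hBC⟩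
  · simp at h

theorem poorCircles_nonempty (hS : StepData β Ω D BC I) :
    (poorCircles β Ω D.verts).Nonempty := by
  obtain ⟨a, ⟨ha, -⟩ | ⟨e, ⟨-, a, ha, -⟩, -⟩⟩ := hS.nonempty
  · obtain ⟨c, hc, -⟩ := hS.exists_of_mem_BC ha
    exact ⟨c, hc⟩
  · obtain ⟨c, hc, -⟩ := hS.exists_of_mem_BC ha
    exact ⟨c, hc⟩

theorem finite (hS : StepData β Ω D BC I) (hD : D.Conforming Ω) : I.Finite := by
  refine (((finite_poorCircles (β := β) (Ω := Ω) hD.finite_verts).image Sum.inl).union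
    (hD.finite_segs.image Sum.inr)).subset ?_
  rintro (c | d) hk
  · exact Or.inl ⟨c, (hS.of_inl_mem hk).1, rfl⟩
  · exact Or.inr ⟨d, (hS.exists_of_inr_mem hk).1, rfl⟩

theorem center_mem (hS : StepData β Ω D BC I) (hD : D.Conforming Ω) {k : Candidate} (hk : k ∈ I) :
    k.center ∈ Ω := by
  rcases k with c | d
  · obtain ⟨p, q, t, h⟩ := (hS.of_inl_mem hk).1.1
    exact closure_minimal interior_subset hD.isCompact.isClosed (hD.circumcenter_mem h)
  · exact hD.segs_subset d (hS.exists_of_inr_mem hk).1 (mid_mem_carrier d)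

theorem conforming (hS : StepData β Ω D BC I) (hD : D.Conforming Ω) :
    (D.insertAll I).Conforming Ω :=
  hD.insertAll (hS.finite hD) (fun _ => hS.center_mem hD)
    (fun _ he => (hS.exists_of_inr_mem he).1) fun _ hc => (hS.of_inl_mem hc).2.1

/-- The place where `√2 ≤ β` is needed: the factor `√2` lost from the encroaching circle to the
diametral one is regained from poor shape. -/
theorem shortestEdge_lt_radius (hS : StepData β Ω D BC I) (hD : D.Conforming Ω) (hβ : √2 ≤ β)
    {d : Seg} (hd : Sum.inr d ∈ I) : shortestEdge Ω D.verts < d.radius := by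
  obtain ⟨hds, b, hb, hbd⟩ := hS.exists_of_inr_mem hd
  have h1 := lt_sqrt_two_mul_radius hbd (le_dist_of_mem_poorCircles hb (hD.fst_mem d hds))
    (le_dist_of_mem_poorCircles hb (hD.snd_mem d hds))
  have h2 := mul_le_mul_of_nonneg_right hβ (shortestEdge_nonneg Ω D.verts)
  have h3 : √2 * shortestEdge Ω D.verts < √2 * d.radius := h2.trans_lt (hb.2.trans h1)
  exact lt_of_mul_lt_mul_left h3 (Real.sqrt_nonneg 2)

theorem shortestEdge_lt_dist_old (hS : StepData β Ω D BC I) (hD : D.Conforming Ω) (hβ : √2 ≤ β)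
    {k : Candidate} (hk : k ∈ I) {v : Plane} (hv : v ∈ D.verts) :
    shortestEdge Ω D.verts < dist v k.center := by
  rcases k with c | d
  · have hc := (hS.of_inl_mem hk).1
    exact (shortestEdge_lt_of_mem_poorCircles hβ hc).trans_le (le_dist_of_mem_poorCircles hc hv)
  · exact (hS.shortestEdge_lt_radius hD hβ hk).trans_le
      (radius_le_dist (hD.vert_notMem_disc d (hS.exists_of_inr_mem hk).1 v hv))

/-- Of two independent circumcircles, one has its centre outside or on the other; inserted
circumcentres do not encroach; and midpoints lie outside the discs of other segments. In each case a
radius above the shortest edge bounds the distance from below. -/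
theorem shortestEdge_lt_dist_new (hS : StepData β Ω D BC I) (hD : D.Conforming Ω) (hβ : √2 ≤ β)
    {k k' : Candidate} (hk : k ∈ I) (hk' : k' ∈ I) (hne : k ≠ k') :
    shortestEdge Ω D.verts < dist k.center k'.center := by
  have mixed : ∀ c d, Sum.inl c ∈ I → Sum.inr d ∈ I →
      shortestEdge Ω D.verts < dist c.1 d.mid := by
    intro c d hc hd
    refine (hS.shortestEdge_lt_radius hD hβ hd).trans_le (radius_le_dist fun h => ?_)
    exact (hS.of_inl_mem hc).2.1 ⟨d, (hS.exists_of_inr_mem hd).1, h⟩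
  rcases k with c | d <;> rcases k' with c' | d'
  · have hc := hS.of_inl_mem hk
    have hc' := hS.of_inl_mem hk'
    by_contra! h
    refine hS.maximal_BC.1.2 hc.2.2 hc'.2.2 hne ⟨?_, ?_⟩
    · exact h.trans_lt (shortestEdge_lt_of_mem_poorCircles hβ hc.1)
    · exact h.trans_lt (shortestEdge_lt_of_mem_poorCircles hβ hc'.1)
  · exact mixed c d' hk hk'
  · rw [dist_comm]
    exact mixed c' d hk' hk
  · refine (hS.shortestEdge_lt_radius hD hβ hk').trans_le (radius_le_dist ?_)
    refine hD.mid_notMem_disc (hS.exists_of_inr_mem hk').1 (hS.exists_of_inr_mem hk).1 ?_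
    rintro rfl
    exact hne rfl

/-- Every pair of vertices that is not old is farther apart than the shortest edge. -/
theorem shortestEdge_lt_dist (hS : StepData β Ω D BC I) (hD : D.Conforming Ω) (hβ : √2 ≤ β)
    {p q : Plane} (hp : p ∈ (D.insertAll I).verts) (hq : q ∈ (D.insertAll I).verts) (hpq : p ≠ q)
    (hold : p ∉ D.verts ∨ q ∉ D.verts) : shortestEdge Ω D.verts < dist p q := by
  rcases hp with hp | ⟨k, hk, rfl⟩ <;> rcases hq with hq | ⟨k', hk', rfl⟩
  · exact absurd hold (by tauto)
  · exact hS.shortestEdge_lt_dist_old hD hβ hk' hp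
  · rw [dist_comm]
    exact hS.shortestEdge_lt_dist_old hD hβ hk hq
  · refine hS.shortestEdge_lt_dist_new hD hβ hk hk' ?_
    rintro rfl
    exact hpq rfl

theorem pairwise_le_dist (hS : StepData β Ω D BC I) (hD : D.Conforming Ω) (hβ : √2 ≤ β) {s : ℝ}
    (hs : D.verts.Pairwise fun p q => s ≤ dist p q) :
    (D.insertAll I).verts.Pairwise fun p q => s ≤ dist p q := by
  intro p hp q hq hpq
  by_cases hold : p ∈ D.verts ∧ q ∈ D.verts
  · exact hs hold.1 hold.2 hpq
  · refine le_trans ?_ (hS.shortestEdge_lt_dist hD hβ hp hq hpq (by tauto)).le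
    exact le_shortestEdge hS.poorCircles_nonempty fun p q h => hs h.1 h.2.1 h.2.2.1

theorem le_dist_of_isDelaunayEdge (hS : StepData β Ω D BC I) (hD : D.Conforming Ω) (hβ : √2 ≤ β)
    {l : ℝ} (hl : ∀ p q, IsDelaunayEdge Ω D.verts p q → l ≤ dist p q) {p q : Plane}
    (hpq : IsDelaunayEdge Ω (D.insertAll I).verts p q) : l ≤ dist p q := by
  obtain ⟨hp, hq, hne, hsub, c, hc, hemp⟩ := hpq
  by_cases hold : p ∈ D.verts ∧ q ∈ D.verts
  -- An edge between old vertices was Delaunay already, since its empty circle was empty of fewer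
  -- points.
  · exact hl p q ⟨hold.1, hold.2, hne, hsub, c, hc, fun v hv => hemp v (Or.inl hv)⟩
  · refine le_trans ?_ (hS.shortestEdge_lt_dist hD hβ hp hq hne (by tauto)).le
    exact le_shortestEdge hS.poorCircles_nonempty hl

end StepData

/-- The midpoint of an encroached segment has an empty disc of radius `d.radius` around it, so a
larger diametral circle would force a larger poor circle. -/
theorem Drawing.Conforming.radius_le (hD : D.Conforming Ω) {d : Seg} {b : Plane × ℝ} {ρ : ℝ}
    (hd : d ∈ D.segs) (hb : b ∈ poorCircles β Ω D.verts) (hbd : b.1 ∈ d.disc)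
    (hρ : ∀ a ∈ poorCircles β Ω D.verts, a.2 ≤ ρ) : d.radius ≤ ρ := by
  by_contra! h
  obtain ⟨p, q, t, hT⟩ := hb.1
  have hρ0 : 0 ≤ ρ := by
    obtain ⟨v, -, hv⟩ := exists_dist_eq_of_mem_poorCircles hb
    exact (hv ▸ dist_nonneg).trans (hρ b hb)
  obtain ⟨a, ha, ha', -⟩ := hD.exists_poorCircle (β := β)
    (hD.mid_mem hd (hD.circumcenter_mem hT) hbd) hρ0
    (fun v hv => h.trans_le (radius_le_dist (hD.vert_notMem_disc d hd v hv)))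
    (hb.2.le.trans (hρ b hb))
  exact (hρ a ha).not_gt ha'

/-- Near every large poor circumcircle, an iteration inserts a point far from all vertices. -/
theorem StepData.exists_new_vertex (hS : StepData β Ω D BC I) (hD : D.Conforming Ω)
    {ρ : ℝ} (hρ : ∀ a ∈ poorCircles β Ω D.verts, a.2 ≤ ρ) {a : Plane × ℝ}
    (ha : a ∈ poorCircles β Ω D.verts) (haρ : ρ / 2 < a.2) :
    ∃ y ∈ (D.insertAll I).verts, (∀ v ∈ D.verts, ρ / 8 ≤ dist v y) ∧ dist y a.1 ≤ 2 * ρ := by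
  have hρ0 : 0 ≤ ρ := by
    have := hρ a ha
    linarith
  obtain ⟨b, hb, hbBC, hbρ, hba⟩ : ∃ b ∈ poorCircles β Ω D.verts, Sum.inl b ∈ BC ∧
      ρ / 4 < b.2 ∧ dist b.1 a.1 ≤ ρ := by
    by_cases haBC : Sum.inl a ∈ BC
    · exact ⟨a, ha, haBC, by linarith, by simpa⟩
    · have haK : Sum.inl a ∈ D.setB β Ω ∪ D.setC β Ω := by
        by_cases hE : D.Encroaches a.1
        · exact Or.inl ⟨a, ⟨ha, hE⟩, rfl⟩
        · exact Or.inr ⟨a, ⟨ha, hE⟩, rfl⟩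
      obtain ⟨k, hk, hconf⟩ := hS.maximal_BC.exists_conflict haK haBC
      obtain ⟨b, hb, rfl⟩ := hS.exists_of_mem_BC hk
      obtain ⟨h1, h2⟩ := hconf
      obtain ⟨v, hv, hvb⟩ := exists_dist_eq_of_mem_poorCircles hb
      have h3 := le_dist_of_mem_poorCircles ha hv
      have h4 := dist_triangle v b.1 a.1
      have h5 := dist_comm a.1 b.1
      -- A vertex on the circle of `b` is at distance at least `a.2` from `a.1` and less than `2 *
      -- b.2`, so `b.2` exceeds `ρ / 4`. Passing to a diametral circle costs a further factor `√2 ≤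
      -- 2`, whence `ρ / 8`.
      exact ⟨b, hb, hk, by linarith, by linarith [hρ a ha]⟩
  have hmid : ∀ d, Sum.inr d ∈ I → b.2 < √2 * d.radius → dist d.mid b.1 ≤ ρ →
      ∃ y ∈ (D.insertAll I).verts, (∀ v ∈ D.verts, ρ / 8 ≤ dist v y) ∧ dist y a.1 ≤ 2 * ρ := by
    intro d hd hlt hdb
    refine ⟨d.mid, Or.inr ⟨_, hd, rfl⟩, fun v hv => ?_, ?_⟩
    · have h1 := radius_le_dist (hD.vert_notMem_disc d (hS.exists_of_inr_mem hd).1 v hv)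
      have h2 : √2 ≤ 2 := Real.sqrt_le_iff.2 (by norm_num)
      have h3 := mul_le_mul_of_nonneg_right h2 d.radius_nonneg
      linarith
    · have := dist_triangle d.mid b.1 a.1
      linarith
  by_cases hE : D.Encroaches b.1
  · obtain ⟨d, hd, hbd⟩ := hE
    have hdI : Sum.inr d ∈ I := hS.setD_subset ⟨d, ⟨hd, _, hbBC, hbd⟩, rfl⟩
    refine hmid d hdI (lt_sqrt_two_mul_radius hbd
      (le_dist_of_mem_poorCircles hb (hD.fst_mem d hd))
      (le_dist_of_mem_poorCircles hb (hD.snd_mem d hd))) ?_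
    have h1 := hD.radius_le hd hb hbd hρ
    have h2 : dist b.1 d.mid < d.radius := hbd
    rw [dist_comm]
    linarith
  · by_cases hbI : Sum.inl b ∈ I
    · refine ⟨b.1, Or.inr ⟨_, hbI, rfl⟩, fun v hv => ?_, by linarith⟩
      have := le_dist_of_mem_poorCircles hb hv
      linarith
    · obtain ⟨k, hk, hconf⟩ := hS.maximal_I.exists_conflict
        (Or.inl ⟨hbBC, b, ⟨hb, hE⟩, rfl⟩) hbI
      rcases k with c | d
      · refine absurd hconf (hS.maximal_BC.1.2 hbBC (hS.of_inl_mem hk).2.2 ?_)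
        rintro h
        exact hbI (h ▸ hk)
      · exact hmid d hk hconf.2 (hconf.1.le.trans (hρ b hb))

/-! ### The number of refinement iterations -/

theorem exists_packing_bound : ∃ N : ℕ, ∀ (c : Plane) (ρ : ℝ) (y : ℕ → Plane) (K : ℕ), 0 < ρ →
    (∀ j < K, dist (y j) c ≤ 4 * ρ) → (∀ i j, i < j → j < K → ρ / 8 ≤ dist (y i) (y j)) →
    K ≤ N := by
  -- Scaling by `8 / ρ` turns radius `4ρ` into `32` and separation `ρ / 8` into `1`; a ball of
  -- radius `1 / 2` then holds at most one of the points.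
  obtain ⟨t, -, ht, hcov⟩ := (isCompact_closedBall (0 : Plane) 32).finite_cover_balls
    (e := 1 / 2) (by norm_num)
  refine ⟨ht.toFinset.card, fun c ρ y K hρ hball hsep => ?_⟩
  have hz : ∀ j : Fin K, ∃ x ∈ t, dist ((8 / ρ) • (y j - c)) x < 1 / 2 := by
    intro j
    have hj : (8 / ρ) • (y j - c) ∈ Metric.closedBall (0 : Plane) 32 := by
      rw [mem_closedBall_zero_iff, norm_smul, Real.norm_of_nonneg (by positivity),
        ← dist_eq_norm]
      calc 8 / ρ * dist (y j) c ≤ 8 / ρ * (4 * ρ) := by gcongr; exact hball j j.2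
        _ = 32 := by field_simp; norm_num
    obtain ⟨x, hx, h⟩ := Set.mem_iUnion₂.1 (hcov hj)
    exact ⟨x, hx, h⟩
  choose x hxt hx using hz
  have hlt : ∀ i j : Fin K, i < j → x i ≠ x j := by
    intro i j hij h
    have h1 := hx i
    have h2 := hx j
    rw [← h] at h2
    have h3 := dist_triangle_right ((8 / ρ) • (y i - c)) ((8 / ρ) • (y j - c)) (x i)
    have h4 : dist ((8 / ρ) • (y i - c)) ((8 / ρ) • (y j - c)) = 8 / ρ * dist (y i) (y j) := by
      rw [dist_smul₀, Real.norm_of_nonneg (by positivity), dist_sub_right]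
    have h5 : 1 ≤ 8 / ρ * dist (y i) (y j) := by
      calc (1 : ℝ) = 8 / ρ * (ρ / 8) := by field_simp
        _ ≤ _ := by gcongr; exact hsep i j hij j.2
    linarith
  have hinj : Function.Injective fun j : Fin K => (⟨x j, ht.mem_toFinset.2 (hxt j)⟩ : ht.toFinset) := by
    intro i j h
    have h' : x i = x j := congrArg Subtype.val h
    rcases lt_trichotomy i j with hij | hij | hij
    · exact absurd h' (hlt i j hij)
    · exact hij
    · exact absurd h'.symm (hlt j i hij)
  simpa using Fintype.card_le_of_injective _ hinj

theorem RefineStep.exists_stepData {D' : Drawing} (h : RefineStep β Ω D D') :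
    ∃ BC I, StepData β Ω D BC I ∧ D' = D.insertAll I := by
  obtain ⟨BC, I, h1, h2, h3, h4, h5⟩ := h
  exact ⟨BC, I, ⟨h1, h2, h3, h4⟩, h5⟩

namespace IsRefinementRun

variable {n : ℕ} {M : ℕ → Drawing}

theorem conforming (hM : IsRefinementRun β Ω D n M) (hD : D.Conforming Ω) {i : ℕ} (hi : i ≤ n) :
    (M i).Conforming Ω := by
  induction i with
  | zero => exact hM.1 ▸ hD
  | succ i ih =>
    obtain ⟨BC, I, hS, h⟩ := (hM.2 i hi).exists_stepData
    exact h ▸ hS.conforming (ih (by omega))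

theorem pairwise_le_dist (hM : IsRefinementRun β Ω D n M) (hD : D.Conforming Ω) (hβ : √2 ≤ β)
    {s : ℝ} (hs : D.verts.Pairwise fun p q => s ≤ dist p q) {i : ℕ} (hi : i ≤ n) :
    (M i).verts.Pairwise fun p q => s ≤ dist p q := by
  induction i with
  | zero => exact hM.1 ▸ hs
  | succ i ih =>
    obtain ⟨BC, I, hS, h⟩ := (hM.2 i hi).exists_stepData
    exact h ▸ hS.pairwise_le_dist (hM.conforming hD (by omega)) hβ (ih (by omega))

theorem verts_subset (hM : IsRefinementRun β Ω D n M) {i j : ℕ} (hij : i ≤ j) (hj : j ≤ n) :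
    (M i).verts ⊆ (M j).verts := by
  induction j, hij using Nat.le_induction with
  | base => exact subset_rfl
  | succ j _ ih =>
    obtain ⟨BC, I, -, h⟩ := (hM.2 j hj).exists_stepData
    rw [h]
    exact (ih (by omega)).trans Set.subset_union_left

theorem shortestEdge_mono (hM : IsRefinementRun β Ω D n M) (hD : D.Conforming Ω) (hβ : √2 ≤ β)
    {i j : ℕ} (hij : i ≤ j) (hj : j ≤ n) (hne : (poorCircles β Ω (M j).verts).Nonempty) :
    shortestEdge Ω (M i).verts ≤ shortestEdge Ω (M j).verts := by
  -- Without an edge in the later mesh the infimum would be the default `0`; nonemptiness is used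
  -- only here and dropped before the induction.
  refine le_shortestEdge hne ?_
  clear hne
  induction j, hij using Nat.le_induction with
  | base => exact fun p q h => shortestEdge_le h
  | succ j _ ih =>
    obtain ⟨BC, I, hS, h⟩ := (hM.2 j hj).exists_stepData
    intro p q hpq
    rw [h] at hpq
    exact hS.le_dist_of_isDelaunayEdge (hM.conforming hD (by omega)) hβ (ih (by omega)) hpq

/-- A poor circumcircle has a poor circumcircle of almost the same size nearby in all earlier
iterations. -/
theorem exists_earlier (hM : IsRefinementRun β Ω D n M) (hD : D.Conforming Ω) (hβ : √2 ≤ β)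
    {i j : ℕ} (hij : i ≤ j) (hj : j ≤ n) {c : Plane × ℝ} (hc : c ∈ poorCircles β Ω (M j).verts)
    {ρ : ℝ} (hρ : ρ < c.2) :
    ∃ a ∈ poorCircles β Ω (M i).verts, ρ < a.2 ∧ dist c.1 a.1 ≤ 2 * a.2 := by
  have hβ0 : 0 ≤ β := (Real.sqrt_nonneg 2).trans hβ
  obtain ⟨p, q, t, hT⟩ := hc.1
  -- The maximum makes the earlier circle both large and poor: the threshold `β * shortestEdge` has
  -- only grown since.
  obtain ⟨a, ha, h1, h2⟩ := (hM.conforming hD (hij.trans hj)).exists_poorCircle (β := β)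
    (ρ := max ρ (β * shortestEdge Ω (M j).verts)) ((hM.conforming hD hj).circumcenter_mem hT)
    ((mul_nonneg hβ0 (shortestEdge_nonneg _ _)).trans (le_max_right _ _))
    (fun v hv => (max_lt hρ hc.2).trans_le
      (le_dist_of_mem_poorCircles hc (hM.verts_subset hij hj hv)))
    ((mul_le_mul_of_nonneg_left (hM.shortestEdge_mono hD hβ hij hj ⟨c, hc⟩) hβ0).trans
      (le_max_right _ _))
  exact ⟨a, ha, (le_max_left _ _).trans_lt h1, h2⟩

theorem radius_le (hM : IsRefinementRun β Ω D n M) (hD : D.Conforming Ω) (hβ : √2 ≤ β)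
    {i j : ℕ} (hij : i ≤ j) (hj : j ≤ n) {ρ : ℝ} (hρ : ∀ a ∈ poorCircles β Ω (M i).verts, a.2 ≤ ρ) :
    ∀ a ∈ poorCircles β Ω (M j).verts, a.2 ≤ ρ := by
  intro c hc
  by_contra! h
  obtain ⟨a, ha, h1, -⟩ := hM.exists_earlier hD hβ hij hj hc h
  exact (hρ a ha).not_gt h1

/-- A bounded number of iterations halves the radius of the largest poor circumcircle. -/
theorem radius_le_half (hM : IsRefinementRun β Ω D n M) (hD : D.Conforming Ω) (hβ : √2 ≤ β)
    {N : ℕ} (hN : ∀ (c : Plane) (ρ : ℝ) (y : ℕ → Plane) (K : ℕ), 0 < ρ →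
      (∀ j < K, dist (y j) c ≤ 4 * ρ) → (∀ i j, i < j → j < K → ρ / 8 ≤ dist (y i) (y j)) →
      K ≤ N)
    {i : ℕ} (hi : i + (N + 1) ≤ n) {ρ : ℝ} (hρ : ∀ a ∈ poorCircles β Ω (M i).verts, a.2 ≤ ρ) :
    ∀ a ∈ poorCircles β Ω (M (i + (N + 1))).verts, a.2 ≤ ρ / 2 := by
  intro c hc
  by_contra! hcρ
  have hρ0 : 0 < ρ := by
    have := hM.radius_le hD hβ (by omega) hi hρ c hc
    linarith
  -- The surviving circle `c` has a trace `a` in each of the `N + 1` meshes, with a new vertex near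
  -- it. Both `dist y a.1` and `dist c.1 a.1` are at most `2ρ`, which gives `4ρ`.
  have hy : ∀ j, ∃ y : Plane, j < N + 1 → y ∈ (M (i + j + 1)).verts ∧
      (∀ v ∈ (M (i + j)).verts, ρ / 8 ≤ dist v y) ∧ dist y c.1 ≤ 4 * ρ := by
    intro j
    by_cases hj : j < N + 1
    · obtain ⟨a, ha, h1, h2⟩ := hM.exists_earlier hD hβ (i := i + j) (by omega) hi hc hcρ
      have hbd := hM.radius_le hD hβ (i := i) (j := i + j) (by omega) (by omega) hρ
      obtain ⟨BC, I, hS, h⟩ := (hM.2 (i + j) (by omega)).exists_stepData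
      obtain ⟨y, hy, hyd, hya⟩ :=
        hS.exists_new_vertex (hM.conforming hD (by omega)) hbd ha h1
      refine ⟨y, fun _ => ⟨h ▸ hy, hyd, ?_⟩⟩
      have h3 := dist_triangle_right y c.1 a.1
      have h4 := hbd a ha
      linarith
    · exact ⟨0, fun h => absurd h hj⟩
  choose y hy using hy
  have := hN c.1 ρ y (N + 1) hρ0 (fun j hj => (hy j hj).2.2) fun j k hjk hk =>
    (hy k hk).2.1 _ (hM.verts_subset (by omega) (by omega) (hy j (by omega)).1)
  omega

theorem radius_le_pow (hM : IsRefinementRun β Ω D n M) (hD : D.Conforming Ω) (hβ : √2 ≤ β)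
    {N : ℕ} (hN : ∀ (c : Plane) (ρ : ℝ) (y : ℕ → Plane) (K : ℕ), 0 < ρ →
      (∀ j < K, dist (y j) c ≤ 4 * ρ) → (∀ i j, i < j → j < K → ρ / 8 ≤ dist (y i) (y j)) →
      K ≤ N) {L : ℝ} (hL : ∀ x ∈ Ω, ∀ y ∈ Ω, dist x y ≤ L) {k : ℕ} (hk : k * (N + 1) ≤ n) :
    ∀ a ∈ poorCircles β Ω (M (k * (N + 1))).verts, a.2 ≤ L / 2 ^ k := by
  induction k with
  | zero =>
    intro a ha
    rw [zero_mul, hM.1] at ha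
    obtain ⟨v, hv, hva⟩ := exists_dist_eq_of_mem_poorCircles ha
    obtain ⟨p, q, t, hT⟩ := ha.1
    rw [pow_zero, div_one, ← hva]
    exact hL v (hD.verts_subset hv) a.1
      (closure_minimal interior_subset hD.isCompact.isClosed (hD.circumcenter_mem hT))
  | succ k ih =>
    rw [pow_succ, ← div_div]
    rw [Nat.succ_mul] at hk ⊢
    exact hM.radius_le_half hD hβ hN hk (ih (by omega))

end IsRefinementRun

theorem exists_refinement_bound : ∃ C : ℝ, 0 < C ∧ ∀ (β : ℝ), √2 ≤ β → ∀ (Ω : Set Plane)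
    (D : Drawing), D.Conforming Ω → ∀ s L : ℝ, 0 < s → 2 ≤ L / s →
    (D.verts.Pairwise fun p q => s ≤ dist p q) → (∀ x ∈ Ω, ∀ y ∈ Ω, dist x y ≤ L) →
    ∀ (n : ℕ) (M : ℕ → Drawing), IsRefinementRun β Ω D n M → (n : ℝ) ≤ C * Real.log (L / s) := by
  obtain ⟨N, hN⟩ := exists_packing_bound
  have hlog2 : 0 < Real.log 2 := Real.log_pos (by norm_num)
  refine ⟨2 * (N + 1) / Real.log 2, by positivity, ?_⟩
  intro β hβ Ω D hD s L hs hLs hsep hL n M hM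
  have hlog : Real.log 2 ≤ Real.log (L / s) := Real.log_le_log (by norm_num) hLs
  rcases n.eq_zero_or_pos with rfl | hn
  · have : 0 ≤ Real.log (L / s) := hlog2.le.trans hlog
    simp only [Nat.cast_zero]
    positivity
  -- `n - 1` ensures that iteration `k * (N + 1)` is still executed, so its mesh has a poor circle,
  -- of radius between `s` and `L / 2 ^ k`.
  set k := (n - 1) / (N + 1) with hk
  have hkn : k * (N + 1) ≤ n - 1 := Nat.div_mul_le_self _ _
  have hnk : n - 1 < (k + 1) * (N + 1) := by
    rw [hk]
    exact Nat.lt_mul_of_div_lt (Nat.lt_succ_self _) (Nat.succ_pos N)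
  obtain ⟨BC, I, hS, -⟩ := (hM.2 (k * (N + 1)) (by omega)).exists_stepData
  obtain ⟨a, ha⟩ := hS.poorCircles_nonempty
  have h1 := hM.radius_le_pow hD hβ hN hL (k := k) (by omega) a ha
  have hsep' := hM.pairwise_le_dist hD hβ hsep (i := k * (N + 1)) (by omega)
  have h2 : s ≤ shortestEdge Ω (M (k * (N + 1))).verts :=
    le_shortestEdge ⟨a, ha⟩ fun p q h => hsep' h.1 h.2.1 h.2.2.1
  have h3 := shortestEdge_lt_of_mem_poorCircles hβ ha
  have h4 : (2 : ℝ) ^ k ≤ L / s := by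
    rw [le_div_iff₀ hs]
    have : s ≤ L / 2 ^ k := by linarith
    rw [le_div_iff₀ (by positivity)] at this
    linarith
  have h5 : k * Real.log 2 ≤ Real.log (L / s) := by
    rw [← Real.log_pow]
    exact Real.log_le_log (by positivity) h4
  have h6 : (n : ℝ) ≤ (k + 1) * (N + 1) := by
    have : n ≤ (k + 1) * (N + 1) := by omega
    exact_mod_cast this
  rw [div_mul_eq_mul_div, le_div_iff₀ hlog2]
  have hN0 : (0 : ℝ) ≤ N + 1 := by positivity
  calc n * Real.log 2 ≤ (k + 1) * (N + 1) * Real.log 2 := by gcongr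
    _ = (N + 1) * (k * Real.log 2 + Real.log 2) := by ring
    _ ≤ (N + 1) * (Real.log (L / s) + Real.log (L / s)) := by gcongr
    _ = 2 * (N + 1) * Real.log (L / s) := by ring

variable {D' : Drawing}

/-! ### Local feature size -/

theorem NonIncident.symm {e f : Seg} (h : NonIncident e f) : NonIncident f e :=
  ⟨h.1.symm, h.2.2.1.symm, h.2.1.symm, h.2.2.2.symm⟩

theorem nonIncident_of_disjoint {e f : Seg} {S T : Set Plane} (h : Disjoint S T)
    (he : e.carrier ⊆ S) (hf : f.carrier ⊆ T) : NonIncident e f := by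
  have key : ∀ x ∈ e.carrier, ∀ y ∈ f.carrier, x ≠ y := fun x hx y hy =>
    h.ne_of_mem (he hx) (hf hy)
  exact ⟨key _ (fst_mem_carrier e) _ (fst_mem_carrier f),
    key _ (fst_mem_carrier e) _ (snd_mem_carrier f),
    key _ (snd_mem_carrier e) _ (fst_mem_carrier f),
    key _ (snd_mem_carrier e) _ (snd_mem_carrier f)⟩

theorem vertex_mem_features {v : Plane} (hv : v ∈ D.verts) : (v, v) ∈ D.features :=
  Or.inr ⟨v, hv, rfl⟩

theorem Drawing.IsPSLG.disjoint_carrier (hP : D.IsPSLG) {e f : Seg} (he : e ∈ D.features)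
    (hf : f ∈ D.features) (hef : NonIncident e f) : Disjoint e.carrier f.carrier := by
  have mixed : ∀ e ∈ D.segs, ∀ v ∈ D.verts, NonIncident e (v, v) →
      Disjoint e.carrier (Seg.carrier (v, v)) := by
    intro e he v hv h
    rw [carrier_vertex, Set.disjoint_singleton_right]
    intro hve
    rcases hP.vert_on_seg e he v hv hve with h' | h'
    · exact h.1 h'.symm
    · exact h.2.2.1 h'.symm
  rcases he with he | ⟨v, hv, rfl⟩ <;> rcases hf with hf | ⟨w, hw, rfl⟩
  · rw [Set.disjoint_left]
    intro x hxe hxf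
    have hx := hP.seg_inter_seg e he f hf (by rintro rfl; exact hef.1 rfl) ⟨hxe, hxf⟩
    rcases hP.vert_on_seg e he x hx hxe with rfl | rfl <;>
    rcases hP.vert_on_seg f hf _ hx hxf with h | h
    · exact hef.1 h
    · exact hef.2.1 h
    · exact hef.2.2.1 h
    · exact hef.2.2.2 h
  · exact mixed e he w hw hef
  · exact (mixed f hf v hv hef.symm).symm
  · rw [carrier_vertex, carrier_vertex, Set.disjoint_singleton]
    exact hef.1

theorem lfs_le {e f : Seg} (he : e ∈ D.features) (hf : f ∈ D.features) (hef : NonIncident e f)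
    {x y z : Plane} {r : ℝ} (hy : y ∈ e.carrier) (hz : z ∈ f.carrier) (hyx : dist y x ≤ r)
    (hzx : dist z x ≤ r) : D.lfs x ≤ r :=
  csInf_le ⟨0, fun _ h => h.1⟩ ⟨dist_nonneg.trans hyx, e, he, f, hf, hef, ⟨y, hyx, hy⟩, ⟨z, hzx, hz⟩⟩

theorem lfs_nonneg (D : Drawing) (x : Plane) : 0 ≤ D.lfs x :=
  Real.sInf_nonneg fun _ h => h.1

theorem minLfs_le_lfs {x : Plane} (hx : x ∈ Ω) : D.minLfs Ω ≤ D.lfs x :=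
  csInf_le ⟨0, by rintro _ ⟨y, -, rfl⟩; exact lfs_nonneg D y⟩ ⟨x, hx, rfl⟩

theorem isCompact_carrier (e : Seg) : IsCompact e.carrier := by
  rw [Seg.carrier, ← convexHull_pair]
  exact (Set.toFinite {e.1, e.2}).isCompact_convexHull ℝ

/-- Non-incident features are disjoint compact sets, and there are finitely many pairs. This makes
`s` positive. -/
theorem Drawing.IsPSLG.exists_pos_le_dist (hP : D.IsPSLG) : ∃ δ : ℝ, 0 < δ ∧
    ∀ e ∈ D.features, ∀ f ∈ D.features, NonIncident e f → ∀ y ∈ e.carrier, ∀ z ∈ f.carrier,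
      δ ≤ dist y z := by
  have hfin : D.features.Finite := hP.finite_segs.union (hP.finite_verts.image _)
  have hev : ∀ᶠ δ : ℝ in nhdsWithin 0 (Set.Ioi 0), ∀ k ∈ D.features ×ˢ D.features,
      NonIncident k.1 k.2 → ∀ y ∈ k.1.carrier, ∀ z ∈ k.2.carrier, δ ≤ dist y z := by
    rw [Filter.eventually_all_finite (hfin.prod hfin)]
    rintro ⟨e, f⟩ ⟨he, hf⟩
    by_cases hef : NonIncident e f
    · obtain ⟨r, hr, h⟩ := Metric.exists_pos_forall_lt_edist (isCompact_carrier e)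
        (isCompact_carrier f).isClosed (hP.disjoint_carrier he hf hef)
      filter_upwards [Ioc_mem_nhdsGT (NNReal.coe_pos.2 hr)] with δ hδ _ y hy z hz
      have := h y hy z hz
      rw [edist_nndist, ENNReal.coe_lt_coe, ← NNReal.coe_lt_coe, coe_nndist] at this
      exact hδ.2.trans this.le
    · exact Filter.Eventually.of_forall fun _ h => absurd h hef
  obtain ⟨δ, h, hδ⟩ := (hev.and self_mem_nhdsWithin).exists
  exact ⟨δ, hδ, fun e he f hf => h (e, f) ⟨he, hf⟩⟩

theorem Drawing.IsPSLG.nonIncident_endpoints (hP : D.IsPSLG) {e : Seg} (he : e ∈ D.segs) :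
    NonIncident (e.1, e.1) (e.2, e.2) :=
  have h := hP.fst_ne_snd e he
  ⟨h, h, h, h⟩

theorem Drawing.IsPSLG.lfs_mid_le (hP : D.IsPSLG) {e : Seg} (he : e ∈ D.segs) :
    D.lfs e.mid ≤ e.radius := by
  refine lfs_le (vertex_mem_features (hP.fst_mem e he)) (vertex_mem_features (hP.snd_mem e he))
    (hP.nonIncident_endpoints he) (fst_mem_carrier _) (fst_mem_carrier _) ?_ ?_
  · simp [Seg.mid, Seg.radius]
    linarith
  · simp [Seg.mid, Seg.radius]
    linarith

theorem Drawing.IsPSLG.minLfs_pos (hP : D.IsPSLG) (hΩ : Ω.Nonempty) (hne : D.segs.Nonempty) :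
    0 < D.minLfs Ω := by
  obtain ⟨δ, hδ, h⟩ := hP.exists_pos_le_dist
  obtain ⟨g, hg⟩ := hne
  refine (half_pos hδ).trans_le (le_csInf (hΩ.image _) ?_)
  rintro _ ⟨x, -, rfl⟩
  refine le_csInf ⟨max (dist g.1 x) (dist g.2 x), dist_nonneg.trans (le_max_left _ _), (g.1, g.1),
    vertex_mem_features (hP.fst_mem g hg), (g.2, g.2), vertex_mem_features (hP.snd_mem g hg),
    hP.nonIncident_endpoints hg, ⟨g.1, Metric.mem_closedBall.2 (le_max_left _ _), fst_mem_carrier _⟩,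
    ⟨g.2, Metric.mem_closedBall.2 (le_max_right _ _), fst_mem_carrier _⟩⟩ ?_
  rintro r ⟨-, e, he, f, hf, hef, ⟨y, hyx, hy⟩, ⟨z, hzx, hz⟩⟩
  have h1 := h e he f hf hef y hy z hz
  have h2 := dist_triangle_right y z x
  rw [Metric.mem_closedBall] at hyx hzx
  linarith

/-- A segment that encloses an angle of at least `π / 2` with `e` does not meet its diametral
disc. -/
theorem disjoint_disc_of_angle {p q r : Plane} (h : Real.pi / 2 ≤ EuclideanGeometry.angle q p r)
    {e f : Seg} (he : e = (p, q) ∨ e = (q, p)) (hf : f = (p, r) ∨ f = (r, p)) :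
    Disjoint e.disc f.carrier := by
  have hin : (q 0 - p 0) * (r 0 - p 0) + (q 1 - p 1) * (r 1 - p 1) ≤ 0 := by
    by_contra! hpos
    have hinner : 0 < inner ℝ (q -ᵥ p) (r -ᵥ p) := by
      simp [EuclideanSpace.inner_eq_star_dotProduct, dotProduct, Fin.sum_univ_two]
      linarith
    exact h.not_gt (Real.arccos_lt_pi_div_two.2
      (div_pos hinner (hinner.trans_le (real_inner_le_norm _ _))))
  rw [Set.disjoint_left]
  intro x hx hxf
  have hx' : (x 0 - p 0) * (x 0 - q 0) + (x 1 - p 1) * (x 1 - q 1) < 0 := by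
    rw [mem_disc_iff] at hx
    rcases he with rfl | rfl
    · exact hx
    · simp only [thales] at hx
      linarith
  obtain ⟨τ, hτ, h0, h1⟩ : ∃ τ : ℝ, 0 ≤ τ ∧ x 0 = p 0 + τ * (r 0 - p 0) ∧
      x 1 = p 1 + τ * (r 1 - p 1) := by
    obtain ⟨a, b, ha, hb, hab, h0, h1⟩ := mem_carrier_iff.1 hxf
    rcases hf with rfl | rfl
    · exact ⟨b, hb, by rw [h0]; linear_combination (p 0) * hab,
        by rw [h1]; linear_combination (p 1) * hab⟩
    · exact ⟨a, ha, by rw [h0]; linear_combination (p 0) * hab,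
        by rw [h1]; linear_combination (p 1) * hab⟩
  have : (x 0 - p 0) * (x 0 - q 0) + (x 1 - p 1) * (x 1 - q 1) =
      τ ^ 2 * ((r 0 - p 0) ^ 2 + (r 1 - p 1) ^ 2) +
      τ * -((q 0 - p 0) * (r 0 - p 0) + (q 1 - p 1) * (r 1 - p 1)) := by
    rw [h0, h1]
    ring
  rw [this] at hx'
  have := mul_nonneg hτ (neg_nonneg.2 hin)
  have : 0 ≤ τ ^ 2 * ((r 0 - p 0) ^ 2 + (r 1 - p 1) ^ 2) := by positivity
  linarith

theorem Drawing.AnglesAtLeastRight.nonIncident (hA : D.AnglesAtLeastRight) {e f : Seg}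
    (he : e ∈ D.segs) (hf : f ∈ D.segs) (hef : e ≠ f) (h : (e.disc ∩ f.carrier).Nonempty) :
    NonIncident e f := by
  have key : ∀ p q r : Plane, (e = (p, q) ∨ e = (q, p)) → (f = (p, r) ∨ f = (r, p)) → False :=
    fun p q r h1 h2 => Set.not_disjoint_iff_nonempty_inter.2 h
      (disjoint_disc_of_angle (hA e he f hf hef p q r h1 h2) h1 h2)
  obtain ⟨a, b⟩ := e
  obtain ⟨c, d⟩ := f
  refine ⟨?_, ?_, ?_, ?_⟩
  · rintro rfl
    exact key a b d (Or.inl rfl) (Or.inl rfl)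
  · rintro rfl
    exact key a b c (Or.inl rfl) (Or.inr rfl)
  · rintro rfl
    exact key b a d (Or.inr rfl) (Or.inl rfl)
  · rintro rfl
    exact key b a c (Or.inr rfl) (Or.inr rfl)

/-! ### The preprocessing -/

/-- In the drawing `D'`, obtained from `D` by splitting segments, a diametral disc is entered only
by parts of features of `D` that are non-incident to the feature of `D` containing the segment. -/
structure Drawing.SplitsFrom (D D' : Drawing) : Prop where
  of_seg : ∀ e ∈ D'.segs, ∀ f ∈ D'.segs, e ≠ f → (e.disc ∩ f.carrier).Nonempty →
    ∃ E ∈ D.features, ∃ F ∈ D.features, NonIncident E F ∧ e.carrier ⊆ E.carrier ∧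
      f.carrier ⊆ F.carrier
  of_vert : ∀ e ∈ D'.segs, ∀ v ∈ D'.verts, v ∈ e.disc →
    ∃ E ∈ D.features, ∃ F ∈ D.features, NonIncident E F ∧ e.carrier ⊆ E.carrier ∧ v ∈ F.carrier

theorem Drawing.splitsFrom_self (hA : D.AnglesAtLeastRight) : D.SplitsFrom D where
  of_seg e he f hf hef h :=
    ⟨e, Or.inl he, f, Or.inl hf, hA.nonIncident he hf hef h, subset_rfl, subset_rfl⟩
  of_vert e he v hv hve := by
    refine ⟨e, Or.inl he, (v, v), vertex_mem_features hv, ?_, subset_rfl, fst_mem_carrier _⟩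
    have h1 : e.1 ≠ v := by
      rintro rfl
      exact fst_notMem_disc e hve
    have h2 : e.2 ≠ v := by
      rintro rfl
      exact snd_notMem_disc e hve
    exact ⟨h1, h1, h2, h2⟩

theorem inr_mem_image_bad {e : Seg} :
    (Sum.inr e : Candidate) ∈ (Sum.inr '' D.bad : Set Candidate) ↔ e ∈ D.bad :=
  Sum.inr_injective.mem_set_image

theorem mem_preStep_segs {h : Seg} : h ∈ D.preStep.segs ↔
    (h ∈ D.segs ∧ h ∉ D.bad) ∨ ∃ e ∈ D.bad, h.IsHalf e := by
  rw [Drawing.preStep, mem_insertAll_segs, inr_mem_image_bad]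
  refine or_congr_right ⟨?_, ?_⟩
  · rintro ⟨e, -, he, hh⟩
    exact ⟨e, inr_mem_image_bad.1 he, hh⟩
  · rintro ⟨e, he, hh⟩
    exact ⟨e, he.1, inr_mem_image_bad.2 he, hh⟩

theorem mem_preStep_verts {v : Plane} : v ∈ D.preStep.verts ↔
    v ∈ D.verts ∨ ∃ e ∈ D.bad, e.mid = v := by
  rw [Drawing.preStep, mem_insertAll_verts]
  refine or_congr_right ⟨?_, ?_⟩
  · rintro ⟨_, ⟨e, he, rfl⟩, rfl⟩
    exact ⟨e, he, rfl⟩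
  · rintro ⟨e, he, rfl⟩
    exact ⟨_, ⟨e, he, rfl⟩, rfl⟩

theorem Drawing.Fits.preStep (hD : D.Fits Ω) : D.preStep.Fits Ω := by
  refine hD.insertAll ((hD.finite_segs.subset fun _ he => he.1).image _) ?_
  rintro _ ⟨e, he, rfl⟩
  exact hD.segs_subset e he.1 (mid_mem_carrier e)

namespace Drawing.SplitsFrom

/-- Halves have smaller discs and carriers than their parents, so the witnessing input features are
inherited; two halves of one segment do not meet each other's discs. -/
theorem preStep (hS : D.SplitsFrom D') : D.SplitsFrom D'.preStep where
  of_seg h hh h' hh' hne hx := by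
    rcases mem_preStep_segs.1 hh with ⟨h1, h2⟩ | ⟨e, he, hhe⟩ <;>
    rcases mem_preStep_segs.1 hh' with ⟨h1', h2'⟩ | ⟨e', he', hhe'⟩
    · exact hS.of_seg h h1 h' h1' hne hx
    · obtain ⟨E, hE, F, hF, hEF, h3, h4⟩ := hS.of_seg h h1 e' he'.1
        (by rintro rfl; exact h2 he')
        (hx.mono (Set.inter_subset_inter_right _ hhe'.carrier_subset))
      exact ⟨E, hE, F, hF, hEF, h3, hhe'.carrier_subset.trans h4⟩
    · obtain ⟨E, hE, F, hF, hEF, h3, h4⟩ := hS.of_seg e he.1 h' h1'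
        (by rintro rfl; exact h2' he)
        (hx.mono (Set.inter_subset_inter_left _ hhe.disc_subset))
      exact ⟨E, hE, F, hF, hEF, hhe.carrier_subset.trans h3, h4⟩
    · by_cases hee : e = e'
      · subst hee
        exact absurd (hhe.disjoint hhe' hne) (Set.not_disjoint_iff_nonempty_inter.2 hx)
      · obtain ⟨E, hE, F, hF, hEF, h3, h4⟩ := hS.of_seg e he.1 e' he'.1 hee
          (hx.mono (Set.inter_subset_inter hhe.disc_subset hhe'.carrier_subset))
        exact ⟨E, hE, F, hF, hEF, hhe.carrier_subset.trans h3, hhe'.carrier_subset.trans h4⟩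
  of_vert h hh v hv hvh := by
    have key : ∀ e ∈ D'.segs, v ∈ e.disc → (e ∈ D'.bad → v ≠ e.mid) →
        ∃ E ∈ D.features, ∃ F ∈ D.features, NonIncident E F ∧ e.carrier ⊆ E.carrier ∧
          v ∈ F.carrier := by
      intro e he hve hne
      rcases mem_preStep_verts.1 hv with hv | ⟨f, hf, rfl⟩
      · exact hS.of_vert e he v hv hve
      · obtain ⟨E, hE, F, hF, hEF, h3, h4⟩ := hS.of_seg e he f hf.1
          (by rintro rfl; exact hne hf rfl) ⟨_, hve, mid_mem_carrier f⟩
        exact ⟨E, hE, F, hF, hEF, h3, h4 (mid_mem_carrier f)⟩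
    rcases mem_preStep_segs.1 hh with ⟨h1, h2⟩ | ⟨e, he, hhe⟩
    · exact key h h1 hvh fun h3 => absurd h3 h2
    · obtain ⟨E, hE, F, hF, hEF, h3, h4⟩ := key e he.1 (hhe.disc_subset hvh) (by
        rintro - rfl
        exact hhe.mid_notMem_disc hvh)
      exact ⟨E, hE, F, hF, hEF, hhe.carrier_subset.trans h3, h4⟩

theorem mem_bad_of_seg (hS : D.SplitsFrom D') (hP : D.IsPSLG) {e f : Seg} (he : e ∈ D'.segs)
    (hf : f ∈ D'.segs) (hef : e ≠ f) (h : (e.disc ∩ f.carrier).Nonempty) : e ∈ D'.bad := by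
  obtain ⟨E, hE, F, hF, hEF, h1, h2⟩ := hS.of_seg e he f hf hef h
  exact ⟨he, f, Or.inl hf, nonIncident_of_disjoint (hP.disjoint_carrier hE hF hEF) h1 h2, h⟩

theorem mem_bad_of_vert (hS : D.SplitsFrom D') (hP : D.IsPSLG) {e : Seg} {v : Plane}
    (he : e ∈ D'.segs) (hv : v ∈ D'.verts) (hve : v ∈ e.disc) : e ∈ D'.bad := by
  obtain ⟨E, hE, F, hF, hEF, h1, h2⟩ := hS.of_vert e he v hv hve
  refine ⟨he, (v, v), vertex_mem_features hv,
    nonIncident_of_disjoint (hP.disjoint_carrier hE hF hEF) h1 ?_, v, hve, fst_mem_carrier _⟩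
  rw [carrier_vertex]
  exact Set.singleton_subset_iff.2 h2

theorem exists_of_mem_bad (hS : D.SplitsFrom D') {e : Seg} (he : e ∈ D'.bad) :
    ∃ E ∈ D.features, ∃ F ∈ D.features, NonIncident E F ∧ e.carrier ⊆ E.carrier ∧
      (e.disc ∩ F.carrier).Nonempty := by
  obtain ⟨he, f, hf | ⟨v, hv, rfl⟩, hef, hx⟩ := he
  · obtain ⟨E, hE, F, hF, hEF, h1, h2⟩ := hS.of_seg e he f hf
      (by rintro rfl; exact hef.1 rfl) hx
    exact ⟨E, hE, F, hF, hEF, h1, hx.mono (Set.inter_subset_inter_right _ h2)⟩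
  · obtain ⟨x, hxe, hxv⟩ := hx
    rw [carrier_vertex] at hxv
    obtain rfl : x = v := hxv
    obtain ⟨E, hE, F, hF, hEF, h1, h2⟩ := hS.of_vert e he x hv hxe
    exact ⟨E, hE, F, hF, hEF, h1, x, hxe, h2⟩

theorem minLfs_le_dist {e E F : Seg} (hE : E ∈ D.features) (hF : F ∈ D.features)
    (hEF : NonIncident E F) (heE : e.carrier ⊆ E.carrier) (heΩ : e.carrier ⊆ Ω) {x : Plane}
    (hx : x ∈ F.carrier) : D.minLfs Ω ≤ dist x e.mid :=
  (minLfs_le_lfs (heΩ (mid_mem_carrier e))).trans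
    (lfs_le hE hF hEF (heE (mid_mem_carrier e)) hx (by simp) le_rfl)

theorem minLfs_le_radius (hS : D.SplitsFrom D') (hD : D'.Fits Ω) {e : Seg} (he : e ∈ D'.bad) :
    D.minLfs Ω ≤ e.radius := by
  obtain ⟨E, hE, F, hF, hEF, h1, x, hxe, hxF⟩ := hS.exists_of_mem_bad he
  have h2 : dist x e.mid < e.radius := hxe
  exact (minLfs_le_dist hE hF hEF h1 (hD.segs_subset e he.1) hxF).trans h2.le

/-- Splitting adds no points to the union of the segments, and new vertices are midpoints on it, so
an unsplit good segment stays good. -/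
theorem exists_isHalf_of_mem_bad (hS : D.SplitsFrom D') (hP : D.IsPSLG) {h : Seg}
    (hh : h ∈ D'.preStep.bad) : ∃ e ∈ D'.bad, h.IsHalf e := by
  obtain ⟨hseg, f, hf, hhf, hx⟩ := hh
  rcases mem_preStep_segs.1 hseg with ⟨h1, h2⟩ | h1
  · exfalso
    have key : ∀ f ∈ D'.segs, h ≠ f → ¬ (h.disc ∩ f.carrier).Nonempty := fun f hf hne hx =>
      h2 (hS.mem_bad_of_seg hP h1 hf hne hx)
    rcases hf with hf | ⟨v, hv, rfl⟩
    · rcases mem_preStep_segs.1 hf with ⟨h3, -⟩ | ⟨e, he, hfe⟩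
      · exact key f h3 (by rintro rfl; exact hhf.1 rfl) hx
      · exact key e he.1 (by rintro rfl; exact h2 he)
          (hx.mono (Set.inter_subset_inter_right _ hfe.carrier_subset))
    · obtain ⟨x, hxh, hxv⟩ := hx
      rw [carrier_vertex] at hxv
      obtain rfl : x = v := hxv
      rcases mem_preStep_verts.1 hv with hv | ⟨e, he, rfl⟩
      · exact h2 (hS.mem_bad_of_vert hP h1 hv hxh)
      · exact key e he.1 (by rintro rfl; exact h2 he) ⟨_, hxh, mid_mem_carrier e⟩
  · exact h1

theorem pairwise_le_dist (hS : D.SplitsFrom D') (hD : D'.Fits Ω)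
    (hs : D'.verts.Pairwise fun p q => D.minLfs Ω ≤ dist p q) :
    D'.preStep.verts.Pairwise fun p q => D.minLfs Ω ≤ dist p q := by
  have key : ∀ e ∈ D'.bad, ∀ q ∈ D'.preStep.verts, q ≠ e.mid → D.minLfs Ω ≤ dist q e.mid := by
    intro e he q hq hne
    -- Inside the disc, `q` belongs to an input feature non-incident to that of `e`, and the local
    -- feature size at `e.mid` bounds the distance; outside, the radius of the bad segment does.
    by_cases hqe : q ∈ e.disc
    · rcases mem_preStep_verts.1 hq with hq | ⟨f, hf, rfl⟩
      · obtain ⟨E, hE, F, hF, hEF, h1, h2⟩ := hS.of_vert e he.1 q hq hqe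
        exact minLfs_le_dist hE hF hEF h1 (hD.segs_subset e he.1) h2
      · obtain ⟨E, hE, F, hF, hEF, h1, h2⟩ := hS.of_seg e he.1 f hf.1
          (by rintro rfl; exact hne rfl) ⟨_, hqe, mid_mem_carrier f⟩
        exact minLfs_le_dist hE hF hEF h1 (hD.segs_subset e he.1) (h2 (mid_mem_carrier f))
    · exact (hS.minLfs_le_radius hD he).trans (radius_le_dist hqe)
  intro p hp q hq hpq
  rcases mem_preStep_verts.1 hp with hp' | ⟨e, he, rfl⟩
  · rcases mem_preStep_verts.1 hq with hq' | ⟨f, hf, rfl⟩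
    · exact hs hp' hq' hpq
    · exact key f hf p hp hpq
  · rw [dist_comm]
    exact key e he q hq hpq.symm

theorem conforming (hS : D.SplitsFrom D') (hP : D.IsPSLG) (hD : D'.Fits Ω) (hbad : D'.bad = ∅) :
    D'.Conforming Ω where
  toFits := hD
  vert_notMem_disc e he v hv hve := by
    have := hS.mem_bad_of_vert hP he hv hve
    simp [hbad] at this
  disjoint_disc e he f hf hef := by
    by_contra h
    have := hS.mem_bad_of_seg hP he hf hef (Set.not_disjoint_iff_nonempty_inter.1 h)
    simp [hbad] at this

end Drawing.SplitsFrom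

theorem Drawing.IsPSLG.fits (hP : D.IsPSLG) (hD : D.Describes Ω) : D.Fits Ω where
  isCompact := hD.isCompact
  finite_verts := hP.finite_verts
  finite_segs := hP.finite_segs
  fst_mem := hP.fst_mem
  snd_mem := hP.snd_mem
  fst_ne_snd := hP.fst_ne_snd
  frontier_subset := hD.frontier_subset
  verts_subset := hD.verts_subset
  segs_subset := hD.segs_subset

theorem minLfs_le_dist_verts (hD : D.verts ⊆ Ω) :
    D.verts.Pairwise fun p q => D.minLfs Ω ≤ dist p q := by
  intro p hp q hq hpq
  refine (minLfs_le_lfs (hD hp)).trans (lfs_le (vertex_mem_features hp) (vertex_mem_features hq)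
    ⟨hpq, hpq, hpq, hpq⟩ (fst_mem_carrier _) (fst_mem_carrier _) (by simp) ?_)
  exact (dist_comm q p).le

/-- The state of the preprocessing after `j` iterations. -/
theorem preStep_iterate (hP : D.IsPSLG) (hA : D.AnglesAtLeastRight) (hD : D.Describes Ω) (j : ℕ) :
    (Drawing.preStep^[j] D).Fits Ω ∧ D.SplitsFrom (Drawing.preStep^[j] D) ∧
    ((Drawing.preStep^[j] D).verts.Pairwise fun p q => D.minLfs Ω ≤ dist p q) ∧
    ∀ e ∈ (Drawing.preStep^[j] D).bad, e.radius ≤ Metric.diam Ω / 2 ^ j := by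
  induction j with
  | zero =>
    refine ⟨hP.fits hD, D.splitsFrom_self hA, minLfs_le_dist_verts hD.verts_subset, ?_⟩
    intro e he
    have h1 := Metric.dist_le_diam_of_mem hD.isCompact.isBounded
      (hD.verts_subset (hP.fst_mem e he.1)) (hD.verts_subset (hP.snd_mem e he.1))
    have h2 : 0 ≤ dist e.1 e.2 := dist_nonneg
    rw [Seg.radius, pow_zero]
    linarith
  | succ j ih =>
    obtain ⟨h1, h2, h3, h4⟩ := ih
    rw [Function.iterate_succ_apply']
    refine ⟨h1.preStep, h2.preStep, h2.pairwise_le_dist h1 h3, ?_⟩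
    intro e he
    obtain ⟨e', he', hee⟩ := h2.exists_isHalf_of_mem_bad hP he
    rw [hee.radius_eq, pow_succ, ← div_div]
    linarith [h4 e' he']

theorem exists_preprocess (hP : D.IsPSLG) (hA : D.AnglesAtLeastRight) (hD : D.Describes Ω)
    (hs : 0 < D.minLfs Ω) (hL : 2 ≤ Metric.diam Ω / D.minLfs Ω) :
    ∃ (m : ℕ) (D₀ : Drawing), Preprocess D m D₀ ∧ D₀.Conforming Ω ∧
      (D₀.verts.Pairwise fun p q => D.minLfs Ω ≤ dist p q) ∧
      (m : ℝ) ≤ 2 / Real.log 2 * Real.log (Metric.diam Ω / D.minLfs Ω) := by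
  have hlog2 : 0 < Real.log 2 := Real.log_pos (by norm_num)
  have hlog : Real.log 2 ≤ Real.log (Metric.diam Ω / D.minLfs Ω) :=
    Real.log_le_log (by norm_num) hL
  have hpow : ∀ j, (Drawing.preStep^[j] D).bad.Nonempty →
      (2 : ℝ) ^ j ≤ Metric.diam Ω / D.minLfs Ω := by
    rintro j ⟨e, he⟩
    obtain ⟨h1, h2, -, h4⟩ := preStep_iterate hP hA hD j
    have h5 := (h2.minLfs_le_radius h1 he).trans (h4 e he)
    rw [le_div_iff₀ (by positivity)] at h5
    rw [le_div_iff₀ hs]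
    linarith
  have hex : ∃ j, (Drawing.preStep^[j] D).bad = ∅ := by
    obtain ⟨j, hj⟩ := pow_unbounded_of_one_lt (Metric.diam Ω / D.minLfs Ω) (one_lt_two (α := ℝ))
    refine ⟨j, ?_⟩
    by_contra hne
    exact (hpow j (Set.nonempty_iff_ne_empty.2 hne)).not_gt hj
  classical
  obtain ⟨h1, h2, h3, -⟩ := preStep_iterate hP hA hD (Nat.find hex)
  have hmin : ∀ j < Nat.find hex, (Drawing.preStep^[j] D).bad.Nonempty := fun j hj =>
    Set.nonempty_iff_ne_empty.2 (Nat.find_min hex hj)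
  refine ⟨Nat.find hex, _, ⟨rfl, Nat.find_spec hex, hmin⟩,
    h2.conforming hP h1 (Nat.find_spec hex), h3, ?_⟩
  rw [div_mul_eq_mul_div, le_div_iff₀ hlog2]
  -- The last iteration that still splits has index one less than the count; the additional `1` is
  -- absorbed by `log 2 ≤ log (L / s)`.
  rcases Nat.eq_zero_or_eq_succ_pred (Nat.find hex) with h | h
  · rw [h, Nat.cast_zero]
    linarith
  · have h5 := Real.log_le_log (by positivity)
      (hpow (Nat.find hex).pred (hmin _ (Nat.lt_of_succ_le h.ge)))
    rw [Real.log_pow] at h5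
    rw [h]
    push_cast
    linarith

end ChewRefinement

/-! ### Combination of the two phases -/

open ChewRefinement in
theorem mainTheorem4 :
    ∃ C : ℝ, 0 < C ∧
      ∀ (β : ℝ) (_ : √2 ≤ β) (Ω : Set ChewRefinement.Plane) (D : ChewRefinement.Drawing)
        (_ : D.IsPSLG) (_ : D.AnglesAtLeastRight) (_ : D.Describes Ω),
        ∃ (m : ℕ) (D₀ : ChewRefinement.Drawing), ChewRefinement.Preprocess D m D₀ ∧
          ∀ (n : ℕ) (M : ℕ → ChewRefinement.Drawing),
            ChewRefinement.IsRefinementRun β Ω D₀ n M →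
              ((m : ℝ) + (n : ℝ) ≤ C * Real.log (Metric.diam Ω / D.minLfs Ω)) ∧
              ((ChewRefinement.poorCircles β Ω (M n).verts).Nonempty →
                ∃ D' : ChewRefinement.Drawing, ChewRefinement.RefineStep β Ω (M n) D') := by
  have hlog2 : 0 < Real.log 2 := Real.log_pos (by norm_num)
  obtain ⟨C, hC, hbound⟩ := exists_refinement_bound
  refine ⟨2 / Real.log 2 + C, by positivity, ?_⟩
  intro β hβ Ω D hP hA hD
  rcases Ω.eq_empty_or_nonempty with rfl | hΩ
  · have hverts : D.verts = ∅ := Set.subset_empty_iff.1 hD.verts_subset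
    have hsegs : D.segs = ∅ := by
      rw [Set.eq_empty_iff_forall_notMem]
      intro e he
      have := hP.fst_mem e he
      simp [hverts] at this
    refine ⟨0, D, ⟨rfl, ?_, by simp⟩, fun n M hM => ⟨?_, exists_refineStep⟩⟩
    · rw [Set.eq_empty_iff_forall_notMem]
      rintro e ⟨he, -⟩
      simp [hsegs] at he
    · rcases n.eq_zero_or_pos with rfl | hn
      -- For empty `Ω` the right-hand side is `0` by the conventions for the diameter, division and
      -- `Real.log 0`, so no iteration is allowed, and none is possible.
      · simp
      · obtain ⟨BC, I, hS, -⟩ := (hM.2 0 hn).exists_stepData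
        obtain ⟨a, ha⟩ := hS.poorCircles_nonempty
        obtain ⟨v, hv, -⟩ := exists_dist_eq_of_mem_poorCircles ha
        rw [hM.1, hverts] at hv
        exact absurd hv (Set.notMem_empty v)
  · obtain ⟨e, he⟩ := segs_nonempty_of_frontier_subset hD.isCompact hΩ hD.frontier_subset
    have hs := hP.minLfs_pos hΩ ⟨e, he⟩
    have hdist : ∀ x ∈ Ω, ∀ y ∈ Ω, dist x y ≤ Metric.diam Ω := fun x hx y hy =>
      Metric.dist_le_diam_of_mem hD.isCompact.isBounded hx hy
    -- At the midpoint of any segment the local feature size is at most half its length, because the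
    -- endpoints are non-incident features.
    have hL : 2 ≤ Metric.diam Ω / D.minLfs Ω := by
      rw [le_div_iff₀ hs]
      have h1 := (minLfs_le_lfs (hD.segs_subset e he (mid_mem_carrier e))).trans (hP.lfs_mid_le he)
      have h2 := hdist _ (hD.verts_subset (hP.fst_mem e he)) _ (hD.verts_subset (hP.snd_mem e he))
      rw [Seg.radius] at h1
      linarith
    obtain ⟨m, D₀, hpre, hconf, hsep, hm⟩ := exists_preprocess hP hA hD hs hL
    refine ⟨m, D₀, hpre, fun n M hM => ⟨?_, exists_refineStep⟩⟩
    have hn := hbound β hβ Ω D₀ hconf _ _ hs hL hsep hdist n M hM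
    linarith
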